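/- For an integer $n\ge 1$ let $B_2^n=\{x\in\mathbb R^n:\|x\|\le 1\}$ be the Euclidean unit ball and $B_\infty^n=\{x\in\mathbb R^n:\max_k|x_k|\le 1\}$ the cube, let $e_{n+1}=(0,\dots,0,1)\in\mathbb R^{n+1}=\mathbb R^n\times\mathbb R$, and let $$F_n^{(2)}=\operatorname{conv}\left(\left(\sqrt{\tfrac{n}{2e\pi}}\,B_2^n\right)\times\{0\}\ \cup\ \left(\tfrac12 B_\infty^n\right)\times\{1\}\right)\subset\mathbb R^{n+1}.$$ Let $j(F_n^{(2)})$ denote the centre of the ellipsoid of maximal volume contained in $F_n^{(2)}$ (the John ellipsoid), and let $g(F_n^{(2)})=\frac{1}{\operatorname{vol}_{n+1}(F_n^{(2)})}\int_{F_n^{(2)}}x\,dx$ be the centroid. Then, for every $n\ge1$, the centre $j(F_n^{(2)})$ is well defined (an ellipsoid of maximal volume in $F_n^{(2)}$ exists, and any two have the same centre), and there are real numbers $j_n$ and $g_n$ with $$j(F_n^{(2)})=j_n\,e_{n+1},\qquad g(F_n^{(2)})=g_n\,e_{n+1},$$ and, as $n\to\infty$, $$j_n=\frac1n+o\left(\frac1n\right),\qquad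 g_n=1-\frac1e-\frac1n\left(1-\frac2e\right)+o\left(\frac1n\right).$$ -/

import Mathlib

open Filter Asymptotics MeasureTheory
open scoped Pointwise

namespace JohnCentroid

/-- The Euclidean unit ball of `ℝⁿ`. -/
def ballTwo (n : ℕ) : Set (EuclideanSpace ℝ (Fin n)) := {x | ‖x‖ ≤ 1}

/-- The cube `max_k |x_k| ≤ 1` of `ℝⁿ`. -/
def ballInf (n : ℕ) : Set (EuclideanSpace ℝ (Fin n)) := {x | ∀ k, |x k| ≤ 1}

/-- The point `(x, t)` of `ℝⁿ × ℝ = ℝⁿ⁺¹`; `t` is the last coordinate. -/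
def atHeight {n : ℕ} (t : ℝ) (x : EuclideanSpace ℝ (Fin n)) :
    EuclideanSpace ℝ (Fin (n + 1)) :=
  WithLp.toLp 2 (Fin.snoc (α := fun _ => ℝ) (fun i => x i) t)

/-- The last standard basis vector of `ℝⁿ⁺¹`. -/
noncomputable def eLast (n : ℕ) : EuclideanSpace ℝ (Fin (n + 1)) :=
  EuclideanSpace.single (Fin.last n) 1

/-- The convex hull of the ball `√(n / (2eπ)) B₂ⁿ` at height `0` and of the cube
`(1/2) B_∞ⁿ` at height `1`. -/
noncomputable def bodyF2 (n : ℕ) : Set (EuclideanSpace ℝ (Fin (n + 1))) :=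
  convexHull ℝ
    (atHeight 0 '' (Real.sqrt ((n : ℝ) / (2 * Real.exp 1 * Real.pi)) • ballTwo n) ∪
      atHeight 1 '' ((1 / 2 : ℝ) • ballInf n))

/-- The (nondegenerate) ellipsoid with centre `p` obtained from the unit ball by the invertible
affine map `x ↦ p + A x`. -/
def ellipsoid {d : ℕ} (p : EuclideanSpace ℝ (Fin d))
    (A : EuclideanSpace ℝ (Fin d) ≃ₗ[ℝ] EuclideanSpace ℝ (Fin d)) :
    Set (EuclideanSpace ℝ (Fin d)) :=
  (fun x => p + A x) '' ballTwo d

/-- `J` is an ellipsoid of maximal volume among the ellipsoids contained in `K`, and `p` is the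
centre of `J`. -/
def IsJohnEllipsoid {d : ℕ} (K J : Set (EuclideanSpace ℝ (Fin d)))
    (p : EuclideanSpace ℝ (Fin d)) : Prop :=
  (∃ A, J = ellipsoid p A) ∧ J ⊆ K ∧ ∀ q B, ellipsoid q B ⊆ K → volume (ellipsoid q B) ≤ volume J

/-- `p` is the centre of an ellipsoid of maximal volume contained in `K`. -/
def IsJohnCenter {d : ℕ} (K : Set (EuclideanSpace ℝ (Fin d)))
    (p : EuclideanSpace ℝ (Fin d)) : Prop :=
  ∃ J, IsJohnEllipsoid K J p

/-- The centroid `(1 / vol K) ∫_K x dx`. -/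
noncomputable def centroid {d : ℕ} (K : Set (EuclideanSpace ℝ (Fin d))) :
    EuclideanSpace ℝ (Fin d) :=
  (volume.real K)⁻¹ • ∫ x in K, x

end JohnCentroid

/-! Write `R` for the bottom radius and `w(t) = R - (R - 1/2) t`. The section of the body at height
`t` is the Minkowski sum of a ball of radius `(1 - t) R` and a cube of half-width `t / 2`. It
contains the ball of radius `w(t)` and lies in the cube of half-width `w(t)`.

John centre. The outer slabs `|y_i| ≤ w(y_last)`, combined with Hadamard's inequality, bound the
squared determinant of any contained ellipsoid of vertical extent `[u, v]` by `((v - u) / 2)^2 (w(u)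
w(v))^n`. The round frustum inside the body contains an axially symmetric ellipsoid attaining this
bound, and equality forces the centre onto the axis (`ellipsoid_subset_bodyF2_bounds`,
`exists_ellipsoid_subset_bodyF2`). What remains is a maximisation over `0 ≤ u ≤ v ≤ 1`. A maximiser
exists by compactness and is unique by a midpoint argument, as `w` is not constant. For large `n` it
is `u = 0`, `v = 2R / ((R - 1/2)(n + 2))`, so the centre has height `v / 2 ~ 1 / n`.

Centroid. Steiner's formula gives the section volumes `∑ C(n,k) c_k t^(n-k) (1-t)^k`, where `c_k` is
`R^k` times the volume of the unit `k`-ball. Beta integrals cancel the binomials, and the height of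
the centroid is `(n + 1 - M) / (n + 2)`, where `M` is the mean of `k` with weights `c_k`, `k ≤ n`.
The choice of `R` gives `(k + 2) c_(k+2) = (n / e) c_k`. Summing this yields `M = n / e` up to
boundary terms in `c_1`, `c_(n-1)`, `c_n`, which tend to zero relative to the total weight. -/

namespace JohnCentroid


/-! ### Sections of the body, with inner and outer bounds -/

/-- The radius of the ball at the bottom of `bodyF2 n`. -/
noncomputable def bottomRadius (n : ℕ) : ℝ := Real.sqrt ((n : ℝ) / (2 * Real.exp 1 * Real.pi))

theorem bottomRadius_nonneg (n : ℕ) : 0 ≤ bottomRadius n := Real.sqrt_nonneg _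

theorem bottomRadius_pos {n : ℕ} (hn : 1 ≤ n) : 0 < bottomRadius n := by
  have : (0 : ℝ) < n := by exact_mod_cast hn
  unfold bottomRadius
  positivity

theorem sq_bottomRadius (n : ℕ) :
    bottomRadius n ^ 2 = (n : ℝ) / (2 * Real.exp 1 * Real.pi) := by
  unfold bottomRadius
  exact Real.sq_sqrt (by positivity)

@[simp] theorem atHeight_castSucc {n : ℕ} (t : ℝ) (x : EuclideanSpace ℝ (Fin n)) (i : Fin n) :
    atHeight t x i.castSucc = x i := by
  simp [atHeight]

@[simp] theorem atHeight_last {n : ℕ} (t : ℝ) (x : EuclideanSpace ℝ (Fin n)) :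
    atHeight t x (Fin.last n) = t := by
  simp [atHeight]

theorem convex_atHeight_image {n : ℕ} (t : ℝ) {s : Set (EuclideanSpace ℝ (Fin n))}
    (hs : Convex ℝ s) : Convex ℝ (atHeight t '' s) := by
  rintro _ ⟨x, hx, rfl⟩ _ ⟨y, hy, rfl⟩ a b ha hb hab
  refine ⟨a • x + b • y, hs hx hy ha hb hab, ?_⟩
  ext i
  refine Fin.lastCases ?_ (fun i => ?_) i
  · simp [← add_mul, hab]
  · simp

theorem ballTwo_eq_closedBall (n : ℕ) : ballTwo n = Metric.closedBall 0 1 := by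
  ext; simp [ballTwo]

theorem convex_ballInf (n : ℕ) : Convex ℝ (ballInf n) := by
  intro x hx y hy a b ha hb hab k
  have h1 := abs_le.1 (hx k)
  have h2 := abs_le.1 (hy k)
  have : (a • x + b • y) k = a * x k + b * y k := by simp
  rw [this, abs_le]
  constructor <;> nlinarith

theorem mem_bodyF2_iff_exists {n : ℕ} {y : EuclideanSpace ℝ (Fin (n + 1))} :
    y ∈ bodyF2 n ↔ 0 ≤ y (Fin.last n) ∧ y (Fin.last n) ≤ 1 ∧
      ∃ u : EuclideanSpace ℝ (Fin n), ‖u‖ ≤ (1 - y (Fin.last n)) * bottomRadius n ∧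
        ∀ i : Fin n, |y i.castSucc - u i| ≤ y (Fin.last n) / 2 := by
  have hb : Convex ℝ (ballTwo n) := by
    rw [ballTwo_eq_closedBall]; exact convex_closedBall _ _
  have hb0 : (0 : EuclideanSpace ℝ (Fin n)) ∈ ballTwo n := by simp [ballTwo]
  have hc0 : (0 : EuclideanSpace ℝ (Fin n)) ∈ ballInf n := by simp [ballInf]
  rw [bodyF2, (convex_atHeight_image 0 (hb.smul _)).convexHull_union
    (convex_atHeight_image 1 ((convex_ballInf n).smul _))
    (Set.Nonempty.image _ ⟨_, Set.smul_mem_smul_set hb0⟩)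
    (Set.Nonempty.image _ ⟨_, Set.smul_mem_smul_set hc0⟩), mem_convexJoin]
  change (∃ a ∈ atHeight 0 '' (bottomRadius n • ballTwo n), _) ↔ _
  constructor
  · rintro ⟨_, ⟨_, ⟨u, hu, rfl⟩, rfl⟩, _, ⟨_, ⟨v, hv, rfl⟩, rfl⟩, a, b, ha, hb, hab, rfl⟩
    have hlast : (a • atHeight 0 (bottomRadius n • u) + b • atHeight 1 ((1 / 2 : ℝ) • v))
        (Fin.last n) = b := by simp
    simp only [hlast]
    refine ⟨hb, by linarith, (a * bottomRadius n) • u, ?_, fun i => ?_⟩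
    · have : ‖u‖ ≤ 1 := hu
      rw [norm_smul, Real.norm_eq_abs, abs_of_nonneg (mul_nonneg ha (bottomRadius_nonneg n))]
      have h := mul_le_mul_of_nonneg_left this (mul_nonneg ha (bottomRadius_nonneg n))
      have : 1 - b = a := by linarith
      rw [this]; linarith
    · have hvi : |v i| ≤ 1 := hv i
      simp only [PiLp.add_apply, PiLp.smul_apply, atHeight_castSucc, smul_eq_mul]
      have : a * (bottomRadius n * u i) + b * (1 / 2 * v i) - a * bottomRadius n * u i
          = b / 2 * v i := by ring
      rw [this, abs_mul, abs_of_nonneg (by positivity)]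
      nlinarith
  · rintro ⟨h0, h1, u, hu, hi⟩
    set t := y (Fin.last n) with ht
    -- When a scaling factor vanishes, its inverse is `0` by convention. This is harmless, since the
    -- vector it multiplies is then zero too.
    refine ⟨_, ⟨_, ⟨((1 - t) * bottomRadius n)⁻¹ • u, ?_, rfl⟩, rfl⟩, _,
      ⟨_, ⟨WithLp.toLp 2 fun i => (t / 2)⁻¹ * (y i.castSucc - u i), ?_, rfl⟩, rfl⟩,
      1 - t, t, by linarith, h0, by ring, ?_⟩
    · have hnn : 0 ≤ (1 - t) * bottomRadius n :=
        mul_nonneg (by linarith) (bottomRadius_nonneg n)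
      change ‖_‖ ≤ 1
      rw [norm_smul, norm_inv, Real.norm_eq_abs, abs_of_nonneg hnn]
      exact inv_mul_le_one_of_le₀ hu hnn
    · intro i
      change |(t / 2)⁻¹ * (y i.castSucc - u i)| ≤ 1
      rw [abs_mul, abs_inv, abs_of_nonneg (by linarith : 0 ≤ t / 2)]
      exact inv_mul_le_one_of_le₀ (hi i) (by linarith)
    · ext i
      refine Fin.lastCases ?_ (fun i => ?_) i
      · simp [← ht]
      · simp only [PiLp.add_apply, PiLp.smul_apply, atHeight_castSucc, smul_eq_mul]
        have e1 : (1 - t) * (bottomRadius n * (((1 - t) * bottomRadius n)⁻¹ * u i)) = u i := by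
          by_cases h : (1 - t) * bottomRadius n = 0
          · rw [h] at hu
            have hu0 := norm_le_zero_iff.1 hu
            simp [hu0]
          · rw [← mul_assoc, mul_inv_cancel_left₀ h]
        have e2 : t * (1 / 2 * ((t / 2)⁻¹ * (y i.castSucc - u i))) = y i.castSucc - u i := by
          by_cases h : t = 0
          · have := hi i
            rw [h, zero_div] at this
            have := abs_nonpos_iff.1 this
            simp [this]
          · field_simp
        rw [e1, e2]; ring

/-- The left-hand sum is the squared distance from `x` to the cube of half-width `s`; the nearest
point is found by clipping each coordinate to `[-s, s]`. -/
theorem sum_excess_sq_le_iff {n : ℕ} (x : Fin n → ℝ) {s r : ℝ} (hs : 0 ≤ s) (hr : 0 ≤ r) :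
    ∑ i, (max (|x i| - s) 0) ^ 2 ≤ r ^ 2 ↔
      ∃ u : EuclideanSpace ℝ (Fin n), ‖u‖ ≤ r ∧ ∀ i, |x i - u i| ≤ s := by
  constructor
  · intro h
    refine ⟨WithLp.toLp 2 fun i => x i - max (-s) (min s (x i)), ?_, fun i => ?_⟩
    · rw [EuclideanSpace.norm_eq]
      refine Real.sqrt_le_iff.2 ⟨hr, le_trans (Finset.sum_le_sum fun i _ => ?_) h⟩
      rw [Real.norm_eq_abs]
      refine pow_le_pow_left₀ (abs_nonneg _) ?_ 2
      change |x i - max (-s) (min s (x i))| ≤ _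
      grind
    · change |x i - (x i - max (-s) (min s (x i)))| ≤ s
      grind
  · rintro ⟨u, hu, hi⟩
    have h2 : ‖u‖ ^ 2 ≤ r ^ 2 := pow_le_pow_left₀ (norm_nonneg _) hu 2
    rw [EuclideanSpace.norm_sq_eq] at h2
    refine le_trans (Finset.sum_le_sum fun i _ => ?_) h2
    rw [Real.norm_eq_abs]
    refine pow_le_pow_left₀ (le_max_right _ _) ?_ 2
    have := hi i
    grind

theorem mem_bodyF2_iff {n : ℕ} {y : EuclideanSpace ℝ (Fin (n + 1))} :
    y ∈ bodyF2 n ↔ 0 ≤ y (Fin.last n) ∧ y (Fin.last n) ≤ 1 ∧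
      ∑ i : Fin n, (max (|y i.castSucc| - y (Fin.last n) / 2) 0) ^ 2
        ≤ ((1 - y (Fin.last n)) * bottomRadius n) ^ 2 := by
  rw [mem_bodyF2_iff_exists]
  refine and_congr_right fun h0 => and_congr_right fun h1 => ?_
  rw [sum_excess_sq_le_iff (fun i => y (Fin.castSucc i)) (by linarith)
    (mul_nonneg (by linarith) (bottomRadius_nonneg n))]

/-- The half-width in direction `e_i` of the section at height `t` of `bodyF2 n`. -/
noncomputable def width (n : ℕ) (t : ℝ) : ℝ := bottomRadius n - (bottomRadius n - 1 / 2) * t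

theorem width_pos {n : ℕ} (hn : 1 ≤ n) {t : ℝ} (h0 : 0 ≤ t) (h1 : t ≤ 1) : 0 < width n t := by
  have := bottomRadius_pos hn
  unfold width
  rcases h1.lt_or_eq with h | rfl
  · nlinarith
  · norm_num

theorem abs_le_width_of_mem {n : ℕ} {y : EuclideanSpace ℝ (Fin (n + 1))} (hy : y ∈ bodyF2 n)
    (i : Fin n) : |y i.castSucc| ≤ width n (y (Fin.last n)) := by
  obtain ⟨h0, h1, u, hu, hi⟩ := mem_bodyF2_iff_exists.1 hy
  have h2 : |u i| ≤ ‖u‖ := PiLp.norm_apply_le u i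
  have h3 := hi i
  unfold width
  have := abs_sub_abs_le_abs_sub (y i.castSucc) (u i)
  linarith

/-- Since `w(t) = (1 - t) R + t / 2`, a vector of norm at most `w(t)` splits proportionally into one
of norm at most `(1 - t) R` and one of norm at most `t / 2`, which lies in the cube. -/
theorem mem_bodyF2_of_norm_le {n : ℕ} (hn : 1 ≤ n) {y : EuclideanSpace ℝ (Fin (n + 1))}
    (h0 : 0 ≤ y (Fin.last n)) (h1 : y (Fin.last n) ≤ 1)
    (h : ∑ i : Fin n, y i.castSucc ^ 2 ≤ width n (y (Fin.last n)) ^ 2) : y ∈ bodyF2 n := by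
  refine mem_bodyF2_iff_exists.2 ⟨h0, h1, ?_⟩
  set t := y (Fin.last n)
  have hw := width_pos hn h0 h1
  have hR := bottomRadius_nonneg n
  set x : EuclideanSpace ℝ (Fin n) := WithLp.toLp 2 fun i => y i.castSucc with hx
  have hxn : ‖x‖ ≤ width n t := by
    rw [EuclideanSpace.norm_eq]
    refine Real.sqrt_le_iff.2 ⟨hw.le, ?_⟩
    simpa [hx] using h
  have hnn : 0 ≤ (1 - t) * bottomRadius n := mul_nonneg (by linarith) hR
  refine ⟨((1 - t) * bottomRadius n / width n t) • x, ?_, fun i => ?_⟩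
  · rw [norm_smul, Real.norm_eq_abs, abs_of_nonneg (by positivity), div_mul_eq_mul_div,
      div_le_iff₀ hw]
    exact mul_le_mul_of_nonneg_left hxn hnn
  · have hxi : |x i| ≤ width n t := (PiLp.norm_apply_le x i).trans hxn
    have e : y i.castSucc - (((1 - t) * bottomRadius n / width n t) • x) i
        = t / 2 / width n t * x i := by
      change x i - ((1 - t) * bottomRadius n / width n t) * x i = _
      field_simp
      unfold width
      ring
    rw [e, abs_mul, abs_of_nonneg (by positivity), div_mul_eq_mul_div, div_le_iff₀ hw]
    exact mul_le_mul_of_nonneg_left hxi (by linarith)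

theorem isClosed_bodyF2 (n : ℕ) : IsClosed (bodyF2 n) := by
  have : bodyF2 n = {y | 0 ≤ y (Fin.last n)} ∩ ({y | y (Fin.last n) ≤ 1} ∩
      {y | ∑ i : Fin n, (max (|y i.castSucc| - y (Fin.last n) / 2) 0) ^ 2
        ≤ ((1 - y (Fin.last n)) * bottomRadius n) ^ 2}) := by
    ext y; exact mem_bodyF2_iff
  rw [this]
  refine (isClosed_le ?_ ?_).inter ((isClosed_le ?_ ?_).inter (isClosed_le ?_ ?_)) <;> fun_prop


/-! ### Determinant bound for contained ellipsoids -/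

/-- Hadamard's inequality. -/
theorem abs_det_le_prod_norm_row {d : ℕ} (M : Matrix (Fin d) (Fin d) ℝ) :
    |M.det| ≤ ∏ i, ‖(WithLp.toLp 2 (M i) : EuclideanSpace ℝ (Fin d))‖ := by
  let b := EuclideanSpace.basisFun (Fin d) ℝ
  have : Fact (Module.finrank ℝ (EuclideanSpace ℝ (Fin d)) = d) := ⟨by simp⟩
  have h := b.toBasis.orientation.abs_volumeForm_apply_le
    (fun i => (WithLp.toLp 2 (M i) : EuclideanSpace ℝ (Fin d)))
  rw [Orientation.volumeForm_robust' _ b, Module.Basis.det_apply] at h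
  have e : b.toBasis.toMatrix (fun i => (WithLp.toLp 2 (M i) : EuclideanSpace ℝ (Fin d)))
      = M.transpose := by
    ext i j
    simp [b, Module.Basis.toMatrix_apply]
  rwa [e, Matrix.det_transpose] at h

/-- The vector `r` such that the `i`-th coordinate of `B x` is the inner product of `r` and `x`. -/
noncomputable def row {d : ℕ} (B : EuclideanSpace ℝ (Fin d) →ₗ[ℝ] EuclideanSpace ℝ (Fin d))
    (i : Fin d) : EuclideanSpace ℝ (Fin d) :=
  WithLp.toLp 2 fun j => B (EuclideanSpace.single j 1) i

theorem apply_eq_inner_row {d : ℕ}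
    (B : EuclideanSpace ℝ (Fin d) →ₗ[ℝ] EuclideanSpace ℝ (Fin d)) (x : EuclideanSpace ℝ (Fin d))
    (i : Fin d) : B x i = inner ℝ (row B i) x := by
  have hx : x = ∑ j, x j • EuclideanSpace.single j (1 : ℝ) := by
    ext k; simp [Pi.single_apply]
  conv_lhs => rw [hx]
  simp [row, PiLp.inner_apply]

theorem det_eq_det_row {d : ℕ}
    (B : EuclideanSpace ℝ (Fin d) →ₗ[ℝ] EuclideanSpace ℝ (Fin d)) :
    LinearMap.det B = (Matrix.of fun i j => row B i j).det := by
  rw [← LinearMap.det_toMatrix (EuclideanSpace.basisFun (Fin d) ℝ).toBasis]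
  congr 1

theorem abs_det_le_prod_norm_sheared_row {d : ℕ}
    (B : EuclideanSpace ℝ (Fin d) →ₗ[ℝ] EuclideanSpace ℝ (Fin d)) (c : Fin d → ℝ) (k : Fin d)
    (hk : c k = 0) : |LinearMap.det B| ≤ ∏ i, ‖row B i + c i • row B k‖ := by
  have h := abs_det_le_prod_norm_row (Matrix.of fun i j => row B i j + c i * row B k j)
  rw [Matrix.det_eq_of_forall_row_eq_smul_add_const (B := Matrix.of fun i j => row B i j) c k hk
    (fun i j => by simp), ← det_eq_det_row] at h
  exact h

/-- The support function of the unit ball is the norm: test at `x = r / ‖r‖`. This turns containment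
in a half-space into a bound on a row of the matrix. -/
theorem add_norm_le_of_forall_add_inner_le {E : Type*} [NormedAddCommGroup E]
    [InnerProductSpace ℝ E] {r : E} {c h : ℝ}
    (H : ∀ x : E, ‖x‖ ≤ 1 → c + inner ℝ r x ≤ h) : c + ‖r‖ ≤ h := by
  have h1 : ‖(‖r‖⁻¹ • r)‖ ≤ 1 := by
    rw [norm_smul, norm_inv, norm_norm]
    exact inv_mul_le_one_of_le₀ le_rfl (norm_nonneg _)
  have h2 := H _ h1
  rw [inner_smul_right, real_inner_self_eq_norm_sq] at h2
  by_cases h0 : ‖r‖ = 0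
  · simpa [h0] using h2
  · have : ‖r‖⁻¹ * ‖r‖ ^ 2 = ‖r‖ := by field_simp
    rwa [this] at h2

/-- Suppose `X ≥ D^2 - m^2`. Adding the two bounds gives `|b| ≤ |q|`. The bound chosen by the sign
of `q` gives `2D|q| ≤ 2|m||b| + q^2 - b^2`. As `|m| < D`, this contradicts `(|q| - |b|)(2D - |q| -
|b|) ≥ 0`, unless equality holds throughout with `q = 0`. -/
theorem le_sq_sub_sq_of_shifted_bounds {X D q m b : ℝ} (hD : |m| < D) (hq : |q| ≤ D)
    (h1 : X + (m + b) ^ 2 ≤ (D - q) ^ 2) (h2 : X + (m - b) ^ 2 ≤ (D + q) ^ 2) :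
    X ≤ D ^ 2 - m ^ 2 ∧ (D ^ 2 - m ^ 2 ≤ X → q = 0) := by
  have hmb : |m * b| = |m| * |b| := abs_mul m b
  have hm := abs_nonneg m
  have hb0 := abs_nonneg b
  have hq0 := abs_nonneg q
  have key : D ^ 2 - m ^ 2 ≤ X →
      2 * D * |q| + (X - (D ^ 2 - m ^ 2)) ≤ 2 * (|m| * |b|) + |q| ^ 2 - |b| ^ 2 := by
    intro _
    rw [← hmb, sq_abs, sq_abs]
    rcases abs_cases q with ⟨e, _⟩ | ⟨e, _⟩ <;> rw [e] <;>
      nlinarith [neg_abs_le (m * b), le_abs_self (m * b)]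
  have hbq : D ^ 2 - m ^ 2 ≤ X → |b| ≤ |q| := fun _ => sq_le_sq.1 (by nlinarith)
  constructor
  · by_contra hX
    push Not at hX
    have := key hX.le
    have h4 := hbq hX.le
    have h3 : 2 * D * |q| < 2 * D * |b| + |q| ^ 2 - |b| ^ 2 := by nlinarith
    nlinarith [mul_nonneg (sub_nonneg.2 h4) (by linarith : 0 ≤ 2 * D - |q| - |b|)]
  · intro hX
    have h0 := key hX
    by_contra hne
    have hqpos : 0 < |q| := abs_pos.2 hne
    rcases hb0.eq_or_lt with hb | hb
    · rw [← hb] at h0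
      nlinarith
    · have h3 : 2 * D * |q| < 2 * D * |b| + |q| ^ 2 - |b| ^ 2 := by nlinarith
      have h4 := hbq hX
      nlinarith [mul_nonneg (sub_nonneg.2 h4) (by linarith : 0 ≤ 2 * D - |q| - |b|)]

/-- Pythagoras along `t` reduces this to the preceding scalar inequality: `X` is the squared norm of
the component of `r` orthogonal to `t`, and `b` is the signed length of the parallel one. -/
theorem norm_sub_smul_sq_le {E : Type*} [NormedAddCommGroup E] [InnerProductSpace ℝ E]
    {r t : E} (ht : t ≠ 0) {m D q : ℝ} (hD : |m| * ‖t‖ < D)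
    (h1 : q + ‖r + m • t‖ ≤ D) (h2 : -q + ‖-r + m • t‖ ≤ D) :
    ‖r + (-(inner ℝ r t / ‖t‖ ^ 2)) • t‖ ^ 2 ≤ D ^ 2 - (m * ‖t‖) ^ 2 ∧
      (D ^ 2 - (m * ‖t‖) ^ 2 ≤ ‖r + (-(inner ℝ r t / ‖t‖ ^ 2)) • t‖ ^ 2 → q = 0) := by
  have hl : 0 < ‖t‖ := norm_pos_iff.2 ht
  set α := inner ℝ r t / ‖t‖ ^ 2 with hα
  have hin : inner ℝ r t = α * ‖t‖ ^ 2 := by rw [hα]; field_simp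
  have e0 : ‖r + (-α) • t‖ ^ 2 = ‖r‖ ^ 2 - α ^ 2 * ‖t‖ ^ 2 := by
    rw [norm_add_sq_real, inner_smul_right, hin, norm_smul, mul_pow, Real.norm_eq_abs, sq_abs]
    ring
  have e1 : ‖r + m • t‖ ^ 2 = ‖r + (-α) • t‖ ^ 2 + (m * ‖t‖ + α * ‖t‖) ^ 2 := by
    rw [e0, norm_add_sq_real, inner_smul_right, hin, norm_smul, mul_pow, Real.norm_eq_abs, sq_abs]
    ring
  have e2 : ‖-r + m • t‖ ^ 2 = ‖r + (-α) • t‖ ^ 2 + (m * ‖t‖ - α * ‖t‖) ^ 2 := by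
    rw [e0, norm_add_sq_real, inner_smul_right, inner_neg_left, hin, norm_smul, mul_pow,
      Real.norm_eq_abs, sq_abs, norm_neg]
    ring
  have n1 := norm_nonneg (r + m • t)
  have n2 := norm_nonneg (-r + m • t)
  refine le_sq_sub_sq_of_shifted_bounds (b := α * ‖t‖) (by rwa [abs_mul, abs_norm])
    (abs_le.2 ⟨by linarith, by linarith⟩) ?_ ?_
  · rw [← e1]
    exact pow_le_pow_left₀ n1 (by linarith) 2
  · rw [← e2]
    exact pow_le_pow_left₀ n2 (by linarith) 2

/-- The squared determinant of the largest axially symmetric ellipsoid in `bodyF2 n` whose extent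
in the last coordinate is `[u, v]`. -/
noncomputable def objective (n : ℕ) (u v : ℝ) : ℝ :=
  ((v - u) / 2) ^ 2 * (width n u * width n v) ^ n

/-- Let `t` be the last row of the matrix and `P` the height of the centre; the extent is `P ± ‖t‖`.
Shearing the other rows to be orthogonal to `t` preserves the determinant, and each then has squared
norm at most `w(P)^2 - (m‖t‖)^2 = w(u) w(v)`. In the equality case every factor is extremal, so the
centre has no horizontal component. -/
theorem ellipsoid_subset_bodyF2_bounds {n : ℕ} (hn : 1 ≤ n)
    {q : EuclideanSpace ℝ (Fin (n + 1))}
    {B : EuclideanSpace ℝ (Fin (n + 1)) ≃ₗ[ℝ] EuclideanSpace ℝ (Fin (n + 1))}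
    (h : ellipsoid q B ⊆ bodyF2 n) :
    ∃ u v, 0 ≤ u ∧ u < v ∧ v ≤ 1 ∧ q (Fin.last n) = (u + v) / 2 ∧
      LinearMap.det (B : EuclideanSpace ℝ (Fin (n + 1)) →ₗ[ℝ] EuclideanSpace ℝ (Fin (n + 1))) ^ 2
        ≤ objective n u v ∧
      (objective n u v ≤ LinearMap.det
        (B : EuclideanSpace ℝ (Fin (n + 1)) →ₗ[ℝ] EuclideanSpace ℝ (Fin (n + 1))) ^ 2 →
        ∀ i : Fin n, q i.castSucc = 0) := by
  set B' : EuclideanSpace ℝ (Fin (n + 1)) →ₗ[ℝ] EuclideanSpace ℝ (Fin (n + 1)) :=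
    B.toLinearMap with hB'
  have hdet : LinearMap.det B' ≠ 0 := (LinearEquiv.isUnit_det' B).ne_zero
  have hmem : ∀ x, ‖x‖ ≤ 1 → q + B' x ∈ bodyF2 n := fun x hx => h ⟨x, hx, rfl⟩
  have hco : ∀ x i, (q + B' x) i = q i + inner ℝ (row B' i) x := fun x i => by
    rw [PiLp.add_apply, apply_eq_inner_row]
  set t := row B' (Fin.last n) with ht
  set P := q (Fin.last n) with hP
  set m := bottomRadius n - 1 / 2 with hm
  have ht0 : t ≠ 0 := by
    intro h0
    apply hdet
    have := abs_det_le_prod_norm_sheared_row B' 0 (Fin.last n) rfl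
    rw [Fin.prod_univ_castSucc] at this
    simpa [← ht, h0] using this
  have hl : 0 < ‖t‖ := norm_pos_iff.2 ht0
  have hlow : -P + ‖-t‖ ≤ 0 := add_norm_le_of_forall_add_inner_le fun x hx => by
    have := (mem_bodyF2_iff_exists.1 (hmem x hx)).1
    rw [hco] at this
    rw [inner_neg_left]
    linarith
  rw [norm_neg] at hlow
  have hhigh : P + ‖t‖ ≤ 1 := add_norm_le_of_forall_add_inner_le fun x hx => by
    have := (mem_bodyF2_iff_exists.1 (hmem x hx)).2.1
    rwa [hco] at this
  have hwu := width_pos hn (t := P - ‖t‖) (by linarith) (by linarith)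
  have hwv := width_pos hn (t := P + ‖t‖) (by linarith) (by linarith)
  have hW : width n (P - ‖t‖) * width n (P + ‖t‖) = width n P ^ 2 - (m * ‖t‖) ^ 2 := by
    unfold width; rw [hm]; ring
  have hD : |m| * ‖t‖ < width n P := by
    unfold width at hwu hwv ⊢
    rw [← hm] at hwu hwv ⊢
    rcases abs_cases m with ⟨e, _⟩ | ⟨e, _⟩ <;> rw [e] <;> nlinarith
  have hside : ∀ i : Fin n, q i.castSucc + ‖row B' i.castSucc + m • t‖ ≤ width n P := fun i => by
    have : (q i.castSucc + m * P) + ‖row B' i.castSucc + m • t‖ ≤ bottomRadius n :=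
      add_norm_le_of_forall_add_inner_le fun x hx => by
        have := (abs_le.1 (abs_le_width_of_mem (hmem x hx) i)).2
        rw [hco, hco, width, ← hm, ← ht, ← hP] at this
        rw [inner_add_left, inner_smul_left, RCLike.conj_to_real]
        linarith
    rw [width, ← hm]; linarith
  have hside' : ∀ i : Fin n, -q i.castSucc + ‖-row B' i.castSucc + m • t‖ ≤ width n P :=
    fun i => by
    have : (-q i.castSucc + m * P) + ‖-row B' i.castSucc + m • t‖ ≤ bottomRadius n :=
      add_norm_le_of_forall_add_inner_le fun x hx => by
        have := (abs_le.1 (abs_le_width_of_mem (hmem x hx) i)).1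
        rw [hco, hco, width, ← hm, ← ht, ← hP] at this
        rw [inner_add_left, inner_neg_left, inner_smul_left, RCLike.conj_to_real]
        linarith
    rw [width, ← hm]; linarith
  have hrow := fun i : Fin n => norm_sub_smul_sq_le ht0 hD (hside i) (hside' i)
  set f : Fin n → ℝ := fun i =>
    ‖row B' i.castSucc + (-(inner ℝ (row B' i.castSucc) t / ‖t‖ ^ 2)) • t‖ ^ 2 with hf
  set W := width n P ^ 2 - (m * ‖t‖) ^ 2 with hWdef
  have hdetle : LinearMap.det B' ^ 2 ≤ ‖t‖ ^ 2 * ∏ i, f i := by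
    have := abs_det_le_prod_norm_sheared_row B'
      (Fin.snoc (α := fun _ => ℝ)
        (fun i : Fin n => -(inner ℝ (row B' i.castSucc) t / ‖t‖ ^ 2)) 0) (Fin.last n) (by simp)
    rw [Fin.prod_univ_castSucc] at this
    simp only [Fin.snoc_castSucc, Fin.snoc_last, zero_smul, add_zero, ← ht] at this
    calc LinearMap.det B' ^ 2 = |LinearMap.det B'| ^ 2 := (sq_abs _).symm
      _ ≤ _ := pow_le_pow_left₀ (abs_nonneg _) this 2
      _ = _ := by rw [mul_pow, ← Finset.prod_pow]; ring
  have hprodle : ∏ i, f i ≤ W ^ n := by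
    calc ∏ i, f i ≤ ∏ _i : Fin n, W :=
          Finset.prod_le_prod (fun i _ => sq_nonneg _) fun i _ => (hrow i).1
      _ = W ^ n := by simp
  have hobj : objective n (P - ‖t‖) (P + ‖t‖) = ‖t‖ ^ 2 * W ^ n := by
    rw [objective, hW]; ring
  refine ⟨P - ‖t‖, P + ‖t‖, by linarith, by linarith, hhigh, by ring, ?_, ?_⟩
  · rw [hobj]
    exact hdetle.trans (mul_le_mul_of_nonneg_left hprodle (sq_nonneg _))
  · rw [hobj]
    intro hge i
    have hWpos : 0 < W := by rw [← hW]; positivity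
    have hge' : W ^ n ≤ ∏ i, f i :=
      le_of_mul_le_mul_left (hge.trans hdetle) (by positivity)
    refine (hrow i).2 ?_
    by_contra hlt
    push Not at hlt
    have hpos : ∀ j ∈ Finset.univ, 0 < f j := fun j _ => by
      refine lt_of_le_of_ne (sq_nonneg _) fun h0 => ?_
      have : ∏ i, f i = 0 := Finset.prod_eq_zero (Finset.mem_univ j) h0.symm
      have := pow_pos hWpos n
      linarith
    have := Finset.prod_lt_prod hpos (fun j _ => (hrow j).1) ⟨i, Finset.mem_univ i, hlt⟩
    rw [Finset.prod_const, Finset.card_univ, Fintype.card_fin] at this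
    exact absurd hge' (not_le.2 this)

/-! ### Volumes of ellipsoids and attainment of the bound -/

theorem volume_ellipsoid {d : ℕ} (p : EuclideanSpace ℝ (Fin d))
    (A : EuclideanSpace ℝ (Fin d) ≃ₗ[ℝ] EuclideanSpace ℝ (Fin d)) :
    volume (ellipsoid p A) = ENNReal.ofReal
      |LinearMap.det (A : EuclideanSpace ℝ (Fin d) →ₗ[ℝ] EuclideanSpace ℝ (Fin d))| *
        volume (ballTwo d) := by
  have : ellipsoid p A = (fun x => p + x) ''
      ((A : EuclideanSpace ℝ (Fin d) →ₗ[ℝ] EuclideanSpace ℝ (Fin d)) '' ballTwo d) := by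
    rw [Set.image_image]; rfl
  rw [this, Set.image_add_left, measure_preimage_add, Measure.addHaar_image_linearMap]

theorem volume_ellipsoid_le_iff {d : ℕ} (p q : EuclideanSpace ℝ (Fin d))
    (A B : EuclideanSpace ℝ (Fin d) ≃ₗ[ℝ] EuclideanSpace ℝ (Fin d)) :
    volume (ellipsoid p A) ≤ volume (ellipsoid q B) ↔
      LinearMap.det (A : EuclideanSpace ℝ (Fin d) →ₗ[ℝ] EuclideanSpace ℝ (Fin d)) ^ 2 ≤
        LinearMap.det (B : EuclideanSpace ℝ (Fin d) →ₗ[ℝ] EuclideanSpace ℝ (Fin d)) ^ 2 := by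
  have h0 : volume (ballTwo d) ≠ 0 := by
    rw [ballTwo_eq_closedBall]
    exact (Metric.measure_closedBall_pos volume _ one_pos).ne'
  have h1 : volume (ballTwo d) ≠ ⊤ := by
    rw [ballTwo_eq_closedBall]
    exact measure_closedBall_lt_top.ne
  rw [volume_ellipsoid, volume_ellipsoid, ENNReal.mul_le_mul_iff_left h0 h1,
    ENNReal.ofReal_le_ofReal_iff (abs_nonneg _), sq_le_sq]

/-- The diagonal linear automorphism with nonzero entries `d`. -/
noncomputable def diagEquiv {k : ℕ} (d : Fin k → ℝ) (hd : ∀ i, d i ≠ 0) :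
    EuclideanSpace ℝ (Fin k) ≃ₗ[ℝ] EuclideanSpace ℝ (Fin k) where
  toFun x := WithLp.toLp 2 fun i => d i * x i
  invFun x := WithLp.toLp 2 fun i => (d i)⁻¹ * x i
  map_add' x y := by ext i; simp [mul_add]
  map_smul' c x := by ext i; simp; ring
  left_inv x := by ext i; simp [hd]
  right_inv x := by ext i; simp [hd]

@[simp] theorem diagEquiv_apply {k : ℕ} (d : Fin k → ℝ) (hd : ∀ i, d i ≠ 0)
    (x : EuclideanSpace ℝ (Fin k)) (i : Fin k) : diagEquiv d hd x i = d i * x i := rfl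

theorem det_diagEquiv {k : ℕ} (d : Fin k → ℝ) (hd : ∀ i, d i ≠ 0) :
    LinearMap.det (diagEquiv d hd : EuclideanSpace ℝ (Fin k) →ₗ[ℝ] EuclideanSpace ℝ (Fin k))
      = ∏ i, d i := by
  rw [det_eq_det_row, ← Matrix.det_diagonal]
  congr 1
  ext i j
  by_cases h : i = j <;> simp [row, h]

theorem exists_ellipsoid_subset_bodyF2 {n : ℕ} (hn : 1 ≤ n) {u v : ℝ} (hu : 0 ≤ u) (huv : u < v)
    (hv : v ≤ 1) :
    ∃ A : EuclideanSpace ℝ (Fin (n + 1)) ≃ₗ[ℝ] EuclideanSpace ℝ (Fin (n + 1)),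
      ellipsoid (((u + v) / 2) • eLast n) A ⊆ bodyF2 n ∧
      LinearMap.det (A : EuclideanSpace ℝ (Fin (n + 1)) →ₗ[ℝ] EuclideanSpace ℝ (Fin (n + 1))) ^ 2
        = objective n u v := by
  have hwu := width_pos hn hu (huv.le.trans hv)
  have hwv := width_pos hn (hu.trans huv.le) hv
  set a := Real.sqrt (width n u * width n v) with ha
  have ha0 : 0 < a := Real.sqrt_pos.2 (by positivity)
  have ha2 : a ^ 2 = width n u * width n v := Real.sq_sqrt (by positivity)
  set b := (v - u) / 2 with hb
  have hb0 : 0 < b := by rw [hb]; linarith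
  have hd : ∀ i : Fin (n + 1), Fin.snoc (α := fun _ => ℝ) (fun _ : Fin n => a) b i ≠ 0 := by
    intro i
    refine Fin.lastCases ?_ (fun i => ?_) i
    · simpa using hb0.ne'
    · simpa using ha0.ne'
  refine ⟨diagEquiv _ hd, ?_, ?_⟩
  · rintro _ ⟨x, hx, rfl⟩
    have hx2 : ∑ i : Fin n, x i.castSucc ^ 2 + x (Fin.last n) ^ 2 ≤ 1 := by
      have : ‖x‖ ≤ 1 := hx
      have : ‖x‖ ^ 2 ≤ 1 := pow_le_one₀ (norm_nonneg _) this
      rw [EuclideanSpace.norm_sq_eq, Fin.sum_univ_castSucc] at this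
      simpa using this
    set s := x (Fin.last n) with hs
    have hS : 0 ≤ ∑ i : Fin n, x i.castSucc ^ 2 := Finset.sum_nonneg fun i _ => sq_nonneg _
    have hs1 : |s| ≤ 1 := abs_le_of_sq_le_sq (by linarith) (by norm_num)
    obtain ⟨hs1, hs2⟩ := abs_le.1 hs1
    have elast : (((u + v) / 2) • eLast n + diagEquiv _ hd x) (Fin.last n)
        = (u + v) / 2 + b * s := by
      simp [eLast, hs]
    have ecast : ∀ i : Fin n, (((u + v) / 2) • eLast n + diagEquiv _ hd x) i.castSucc
        = a * x i.castSucc := by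
      intro i
      simp [eLast, Fin.castSucc_ne_last]
    refine mem_bodyF2_of_norm_le hn ?_ ?_ ?_
    · simp only [elast]; nlinarith
    · simp only [elast]; nlinarith
    · simp only [elast, ecast]
      calc ∑ i : Fin n, (a * x i.castSucc) ^ 2 = a ^ 2 * ∑ i : Fin n, x i.castSucc ^ 2 := by
            simp only [mul_pow, Finset.mul_sum]
        _ ≤ a ^ 2 * (1 - s ^ 2) := mul_le_mul_of_nonneg_left (by linarith) (sq_nonneg _)
        -- With `W` the width at the midpoint and `m` minus the slope, `a^2 = W^2 - (mb)^2`, and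
        -- `(W^2 - (mb)^2)(1 - s^2) = (W - mbs)^2 - (Ws - mb)^2`.
        _ = (width n ((u + v) / 2 + b * s)) ^ 2 - (width n ((u + v) / 2) * s
              - (bottomRadius n - 1 / 2) * b) ^ 2 := by
            rw [ha2, hb]; unfold width; ring
        _ ≤ _ := by linarith [sq_nonneg (width n ((u + v) / 2) * s - (bottomRadius n - 1 / 2) * b)]
  · rw [det_diagEquiv, Fin.prod_univ_castSucc]
    simp only [Fin.snoc_castSucc, Fin.snoc_last, Finset.prod_const, Finset.card_univ,
      Fintype.card_fin]
    rw [objective, ← hb, ← ha2]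
    ring

/-! ### The two-parameter maximisation and the John centre -/

/-- Equality would mean `n = eπ / 2`, which lies strictly between 4 and 5. A constant width would
break the uniqueness argument. -/
theorem bottomRadius_ne_half (n : ℕ) : bottomRadius n ≠ 1 / 2 := by
  intro h
  have h1 := sq_bottomRadius n
  rw [h, eq_div_iff (by positivity)] at h1
  have e1 := Real.exp_one_gt_d9
  have e2 := Real.exp_one_lt_d9
  have p1 := Real.pi_gt_d2
  have p2 := Real.pi_lt_d2
  have l : (4 : ℝ) < n := by nlinarith
  have r : (n : ℝ) < 5 := by nlinarith
  have l' : 4 < n := by exact_mod_cast l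
  have r' : n < 5 := by exact_mod_cast r
  omega

/-- `(u, v)` maximizes `objective n` among the intervals `[u, v] ⊆ [0, 1]`. -/
def IsOptimal (n : ℕ) (u v : ℝ) : Prop :=
  0 ≤ u ∧ u ≤ v ∧ v ≤ 1 ∧
    ∀ u' v', 0 ≤ u' → u' ≤ v' → v' ≤ 1 → objective n u' v' ≤ objective n u v

theorem exists_isOptimal (n : ℕ) : ∃ u v, IsOptimal n u v := by
  let T : Set (ℝ × ℝ) := (Set.Icc 0 1 ×ˢ Set.Icc 0 1) ∩ {p | p.1 ≤ p.2}
  have hT : IsCompact T :=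
    (isCompact_Icc.prod isCompact_Icc).inter_right (isClosed_le continuous_fst continuous_snd)
  have hc : Continuous fun p : ℝ × ℝ => objective n p.1 p.2 := by
    unfold objective width; fun_prop
  obtain ⟨⟨u, v⟩, ⟨⟨hu, hv⟩, huv⟩, hmax⟩ := hT.exists_isMaxOn
    ⟨(0, 0), by simp [T]⟩ hc.continuousOn
  refine ⟨u, v, hu.1, huv, hv.2, fun u' v' h1 h2 h3 => ?_⟩
  exact hmax (show (u', v') ∈ T from ⟨⟨⟨h1, h2.trans h3⟩, h1.trans h2, h3⟩, h2⟩)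

theorem objective_pos {n : ℕ} (hn : 1 ≤ n) {u v : ℝ} (hu : 0 ≤ u) (huv : u < v) (hv : v ≤ 1) :
    0 < objective n u v := by
  have hwu := width_pos hn hu (huv.le.trans hv)
  have hwv := width_pos hn (hu.trans huv.le) hv
  have : 0 < v - u := by linarith
  unfold objective
  positivity

theorem IsOptimal.lt {n : ℕ} (hn : 1 ≤ n) {u v : ℝ} (h : IsOptimal n u v) : u < v := by
  refine lt_of_le_of_ne h.2.1 fun e => ?_
  have h1 := h.2.2.2 0 1 le_rfl zero_le_one le_rfl
  have h2 := objective_pos hn le_rfl zero_lt_one le_rfl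
  rw [e] at h1
  simp only [objective, sub_self] at h1 h2
  norm_num at h1
  norm_num at h2
  linarith

theorem eq_zero_of_perturbed_product_le {n : ℕ} (hn : 1 ≤ n) {p A B c α β : ℝ} (hp : 0 < p)
    (hA : 0 < A) (hB : 0 < B) (hc : 0 ≤ c) (hα : 0 ≤ α) (hβ : 0 ≤ β)
    (h : (p + c) ^ 2 * ((A + α) * (B + β)) ^ n ≤ p ^ 2 * (A * B) ^ n) : α = 0 ∧ β = 0 := by
  by_contra hne
  have hlt : A * B < (A + α) * (B + β) := by
    rcases hα.eq_or_lt with h0 | h0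
    · rcases hβ.eq_or_lt with h1 | h1
      · exact absurd ⟨h0.symm, h1.symm⟩ hne
      · nlinarith [mul_pos hA h1, mul_nonneg hα hB.le, mul_nonneg hα hβ]
    · nlinarith [mul_pos h0 hB, mul_nonneg hA.le hβ, mul_nonneg hα hβ]
  have h1 : (A * B) ^ n < ((A + α) * (B + β)) ^ n :=
    pow_lt_pow_left₀ hlt (by positivity) (by omega)
  have h2 : p ^ 2 ≤ (p + c) ^ 2 := pow_le_pow_left₀ hp.le (by linarith) 2
  exact absurd h (not_le.2 (mul_lt_mul' h2 h1 (by positivity) (by positivity)))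

/-- Each factor of the objective is affine, so its square at the midpoint of two optima is the
product of its end values plus a square. The midpoint would do strictly better unless the squares
coming from the widths vanish, which forces equal endpoints because the slope is nonzero. -/
theorem IsOptimal.unique {n : ℕ} (hn : 1 ≤ n) {u v u' v' : ℝ} (h : IsOptimal n u v)
    (h' : IsOptimal n u' v') : u = u' ∧ v = v' := by
  have huv := h.lt hn
  have huv' := h'.lt hn
  obtain ⟨hu, -, hv, hmax⟩ := h
  obtain ⟨hu', -, hv', hmax'⟩ := h'
  have wu := width_pos hn hu (huv.le.trans hv)
  have wv := width_pos hn (hu.trans huv.le) hv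
  have wu' := width_pos hn hu' (huv'.le.trans hv')
  have wv' := width_pos hn (hu'.trans huv'.le) hv'
  have heq : objective n u v = objective n u' v' :=
    le_antisymm (hmax' _ _ hu huv.le hv) (hmax _ _ hu' huv'.le hv')
  have hpos := objective_pos hn hu huv hv
  have hmid := hmax ((u + u') / 2) ((v + v') / 2) (by linarith) (by linarith) (by linarith)
  set m := bottomRadius n - 1 / 2 with hm
  have hm0 : m ≠ 0 := sub_ne_zero.2 (bottomRadius_ne_half n)
  have sqw : ∀ x y, width n ((x + y) / 2) ^ 2
      = width n x * width n y + (m * (x - y) / 2) ^ 2 := by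
    intro x y; unfold width; rw [← hm]; ring
  set p := (v - u) / 2 * ((v' - u') / 2) with hp
  have hp0 : 0 < p := mul_pos (by linarith) (by linarith)
  set c := ((v - u) - (v' - u')) / 4 with hc
  have sqp : (((v + v') / 2 - (u + u') / 2) / 2) ^ 2 = p + c ^ 2 := by rw [hp, hc]; ring
  have hsq : objective n ((u + u') / 2) ((v + v') / 2) ^ 2 = (p + c ^ 2) ^ 2 *
      ((width n u * width n u' + (m * (u - u') / 2) ^ 2) *
        (width n v * width n v' + (m * (v - v') / 2) ^ 2)) ^ n := by
    rw [objective, ← sqp, ← sqw, ← sqw]; ring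
  have hprod : objective n u v ^ 2 = p ^ 2 *
      ((width n u * width n u') * (width n v * width n v')) ^ n := by
    rw [sq]; nth_rewrite 2 [heq]
    rw [objective, objective, hp]
    simp only [mul_pow]; ring
  have hmid2 : objective n ((u + u') / 2) ((v + v') / 2) ^ 2 ≤ objective n u v ^ 2 :=
    pow_le_pow_left₀ (objective_pos hn (by linarith) (by linarith) (by linarith)).le hmid 2
  rw [hsq, hprod] at hmid2
  obtain ⟨hu0, hv0⟩ := eq_zero_of_perturbed_product_le hn hp0 (mul_pos wu wu') (mul_pos wv wv')
    (sq_nonneg c) (sq_nonneg _) (sq_nonneg _) hmid2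
  have cancel : ∀ x y, (m * (x - y) / 2) ^ 2 = 0 → x = y := fun x y h0 => by
    have h1 : m * (x - y) = 0 := by have := pow_eq_zero_iff two_ne_zero |>.1 h0; linarith
    exact sub_eq_zero.1 ((mul_eq_zero.1 h1).resolve_left hm0)
  exact ⟨cancel _ _ hu0, cancel _ _ hv0⟩

theorem IsOptimal.isJohnCenter_iff {n : ℕ} (hn : 1 ≤ n) {u v : ℝ} (h : IsOptimal n u v)
    (p : EuclideanSpace ℝ (Fin (n + 1))) :
    IsJohnCenter (bodyF2 n) p ↔ p = ((u + v) / 2) • eLast n := by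
  obtain ⟨A, hA, hdetA⟩ := exists_ellipsoid_subset_bodyF2 hn h.1 (h.lt hn) h.2.2.1
  constructor
  · rintro ⟨_, ⟨B, rfl⟩, hsub, hmax⟩
    obtain ⟨u', v', h0, hlt, h1, hlast, hle, heq⟩ := ellipsoid_subset_bodyF2_bounds hn hsub
    have hAB := (volume_ellipsoid_le_iff _ _ _ _).1 (hmax _ A hA)
    rw [hdetA] at hAB
    have hle' := h.2.2.2 u' v' h0 hlt.le h1
    have hopt : IsOptimal n u' v' := ⟨h0, hlt.le, h1, fun x y hx hxy hy =>
      (h.2.2.2 x y hx hxy hy).trans (hAB.trans hle)⟩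
    obtain ⟨rfl, rfl⟩ := h.unique hn hopt
    have hz := heq hAB
    ext i
    refine Fin.lastCases ?_ (fun i => ?_) i
    · simp [eLast, hlast]
    · simp [eLast, hz, Fin.castSucc_ne_last]
  · rintro rfl
    refine ⟨_, ⟨A, rfl⟩, hA, fun q B hB => ?_⟩
    obtain ⟨u', v', h0, hlt, h1, -, hle, -⟩ := ellipsoid_subset_bodyF2_bounds hn hB
    rw [volume_ellipsoid_le_iff, hdetA]
    exact hle.trans (h.2.2.2 u' v' h0 hlt.le h1)

/-- With decreasing width, moving `u` down to `0` only helps. The given `v` is the critical point of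
`y^2 w(y)^n`. -/
theorem isOptimal_of_half_lt {n : ℕ} (hR : 1 / 2 < bottomRadius n)
    (h1 : 2 * bottomRadius n ≤ (bottomRadius n - 1 / 2) * (n + 2)) :
    IsOptimal n 0 (2 * bottomRadius n / ((bottomRadius n - 1 / 2) * (n + 2))) := by
  set R := bottomRadius n with hRdef
  set m := R - 1 / 2 with hm
  have hm0 : 0 < m := by linarith
  have hR0 : 0 < R := by linarith
  have hw : ∀ t, width n t = R - m * t := fun t => rfl
  set v := 2 * R / (m * (n + 2)) with hv
  have hv0 : 0 < v := by positivity
  have hv1 : v ≤ 1 := by rw [hv, div_le_one (by positivity)]; exact h1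
  have hn : 0 < (n : ℝ) := by
    rcases Nat.eq_zero_or_pos n with h0 | h0
    · exfalso
      have e : R = 0 := by rw [hRdef, h0]; simp [bottomRadius]
      linarith
    · exact_mod_cast h0
  have hwv : width n v = R * n / (n + 2) := by rw [hw, hv]; field_simp; ring
  refine ⟨le_rfl, hv0.le, hv1, fun x y hx hxy hy => ?_⟩
  have wpos : ∀ t, t ≤ 1 → 0 < width n t := fun t ht => by rw [hw]; nlinarith
  have wy := wpos y hy
  have wx := wpos x (hxy.trans hy)
  have wv := wpos v hv1
  have hy0 : 0 ≤ y := hx.trans hxy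
  have step1 : objective n x y ≤ objective n 0 y := by
    unfold objective
    have : width n x ≤ width n 0 := by rw [hw, hw]; nlinarith
    gcongr
  have step2 : y ^ 2 * width n y ^ n ≤ v ^ 2 * width n v ^ n := by
    -- Bounding both ratios by `x ≤ exp (x - 1)` leaves a total exponent affine in `y`, which
    -- vanishes identically because `v` is critical.
    have e1 : y / v ≤ Real.exp (y / v - 1) := by linarith [Real.add_one_le_exp (y / v - 1)]
    have e2 : width n y / width n v ≤ Real.exp (width n y / width n v - 1) := by
      linarith [Real.add_one_le_exp (width n y / width n v - 1)]
    have e3 : (y / v) ^ 2 * (width n y / width n v) ^ n ≤ 1 := by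
      calc (y / v) ^ 2 * (width n y / width n v) ^ n
          ≤ Real.exp (y / v - 1) ^ 2 * Real.exp (width n y / width n v - 1) ^ n := by gcongr
        _ = Real.exp (2 * (y / v - 1) + n * (width n y / width n v - 1)) := by
            rw [Real.exp_add, ← Real.exp_nat_mul, ← Real.exp_nat_mul]; norm_num
        _ = 1 := by
            rw [Real.exp_eq_one_iff, hwv, hw, hv]
            field_simp
            ring
    rw [div_pow y v, div_pow (width n y), div_mul_div_comm, div_le_one (by positivity)] at e3
    exact e3
  refine step1.trans ?_
  have hobj : ∀ t, objective n 0 t = width n 0 ^ n / 4 * (t ^ 2 * width n t ^ n) := by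
    intro t; unfold objective; rw [mul_pow]; ring
  rw [hobj, hobj]
  have := wpos 0 zero_le_one
  gcongr


/-! ### Steiner's formula and moments of the height -/

theorem lintegral_pi_fin_succ {n : ℕ} (p : Fin (n + 1)) {f : (Fin (n + 1) → ℝ) → ENNReal}
    (hf : Measurable f) : ∫⁻ x, f x = ∫⁻ z : ℝ, ∫⁻ y : Fin n → ℝ, f (p.insertNth z y) := by
  have h := (volume_preserving_piFinSuccAbove (fun _ : Fin (n + 1) => ℝ) p).symm
  rw [← h.lintegral_comp hf, Measure.volume_eq_prod, lintegral_prod]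
  · rfl
  · exact (hf.comp h.measurable).aemeasurable

/-- The interval `[-s, s]` contributes mass `2s` at excess zero, and the two outer half-lines,
translated by `s`, reassemble the line up to a null point. -/
theorem lintegral_excess_sq {H : ℝ → ENNReal} (hH : Measurable H) {s : ℝ} (hs : 0 ≤ s) :
    ∫⁻ z : ℝ, H ((max (|z| - s) 0) ^ 2) = ENNReal.ofReal (2 * s) * H 0 + ∫⁻ z : ℝ, H (z ^ 2) := by
  set P : ℝ → ENNReal := (Set.Ioi 0).indicator fun z => H (z ^ 2) with hP
  set N : ℝ → ENNReal := (Set.Iio 0).indicator fun z => H (z ^ 2) with hN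
  have hPm : Measurable P := (hH.comp (by fun_prop)).indicator measurableSet_Ioi
  have hNm : Measurable N := (hH.comp (by fun_prop)).indicator measurableSet_Iio
  have e1 : ∀ z, H ((max (|z| - s) 0) ^ 2)
      = (Set.Icc (-s) s).indicator (fun _ => H 0) z + (P (z - s) + N (z + s)) := by
    intro z
    rcases lt_trichotomy |z| s with h | h | h
    · have h' := abs_lt.1 h
      rw [max_eq_right (by linarith), Set.indicator_of_mem (by constructor <;> linarith),
        hP, hN, Set.indicator_of_notMem (by simp; linarith),
        Set.indicator_of_notMem (by simp; linarith)]
      simp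
    · have h' := abs_le.1 h.le
      rw [max_eq_right (by linarith), Set.indicator_of_mem (by constructor <;> linarith),
        hP, hN, Set.indicator_of_notMem (by simp; linarith),
        Set.indicator_of_notMem (by simp; linarith)]
      simp
    · rw [max_eq_left (by linarith), Set.indicator_of_notMem (s := Set.Icc (-s) s)
        (fun hz => absurd (abs_le.2 hz) (not_le.2 h))]
      rcases abs_cases z with ⟨e, hz⟩ | ⟨e, hz⟩
      · rw [hP, hN, Set.indicator_of_mem (by simp; linarith),
          Set.indicator_of_notMem (by simp; linarith), e]
        simp
      · rw [hP, hN, Set.indicator_of_notMem (by simp; linarith),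
          Set.indicator_of_mem (by simp; linarith), e]
        rw [show -z - s = -(z + s) by ring, neg_sq]
        simp
  have e2 : ∀ᵐ z : ℝ, H (z ^ 2) = P z + N z := by
    filter_upwards [compl_mem_ae_iff.2 (measure_singleton (0 : ℝ))] with z hz
    rcases lt_or_gt_of_ne (hz : z ≠ 0) with h | h
    · simp [hP, hN, h, h.le]
    · simp [hP, hN, h, h.le]
  simp_rw [e1]
  rw [lintegral_congr_ae e2, lintegral_add_left (measurable_const.indicator measurableSet_Icc),
    lintegral_add_left (show Measurable fun z => P (z - s) from hPm.comp (by fun_prop)),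
    lintegral_add_left hPm,
    lintegral_sub_right_eq_self P, lintegral_add_right_eq_self N,
    lintegral_indicator_const measurableSet_Icc, Real.volume_Icc]
  rw [mul_comm, show s - -s = 2 * s by ring]

/-- The integral of a radial function on `ℝᵏ`, as a function of the squared norm. -/
noncomputable def radialIntegral (k : ℕ) (F : ℝ → ENNReal) : ENNReal :=
  ∫⁻ y : Fin k → ℝ, F (∑ i, y i ^ 2)

theorem measurable_radialIntegral_add (k : ℕ) {F : ℝ → ENNReal} (hF : Measurable F) :
    Measurable fun a => radialIntegral k fun b => F (a + b) := by
  unfold radialIntegral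
  exact Measurable.lintegral_prod_right' (f := fun p : ℝ × (Fin k → ℝ) => F (p.1 + ∑ i, p.2 i ^ 2))
    (hF.comp (by fun_prop))

theorem radialIntegral_succ (k : ℕ) {F : ℝ → ENNReal} (hF : Measurable F) :
    radialIntegral (k + 1) F = ∫⁻ z : ℝ, radialIntegral k fun b => F (z ^ 2 + b) := by
  unfold radialIntegral
  rw [lintegral_pi_fin_succ 0 (f := fun y => F (∑ i, y i ^ 2)) (hF.comp (by fun_prop))]
  simp [Fin.sum_univ_succ]

/-- Steiner's formula for the cube of side `2 s`. -/
theorem lintegral_sum_excess_sq (n : ℕ) {s : ℝ} (hs : 0 ≤ s) {F : ℝ → ENNReal}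
    (hF : Measurable F) :
    ∫⁻ x : Fin n → ℝ, F (∑ i, (max (|x i| - s) 0) ^ 2) =
      ∑ ij ∈ Finset.HasAntidiagonal.antidiagonal n,
        (n.choose ij.1 : ENNReal) * (ENNReal.ofReal (2 * s) ^ ij.2 * radialIntegral ij.1 F) := by
  induction n generalizing F with
  | zero => simp [radialIntegral, volume_pi]
  -- Splitting off one coordinate shifts the argument of `F`, hence the induction over all `F`. The
  -- two terms of the one-dimensional formula recombine by Pascal's rule.
  | succ n ih =>
    rw [lintegral_pi_fin_succ 0 (f := fun x => F (∑ i, (max (|x i| - s) 0) ^ 2))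
      (hF.comp (by fun_prop))]
    have e1 : ∀ z : ℝ, ∫⁻ y : Fin n → ℝ, F (∑ i, (max (|Fin.insertNth (α := fun _ => ℝ) 0 z y i|
        - s) 0) ^ 2) = ∑ ij ∈ Finset.HasAntidiagonal.antidiagonal n, (n.choose ij.1 : ENNReal) *
          (ENNReal.ofReal (2 * s) ^ ij.2 *
            radialIntegral ij.1 fun b => F ((max (|z| - s) 0) ^ 2 + b)) := by
      intro z
      rw [← ih (F := fun b => F ((max (|z| - s) 0) ^ 2 + b)) (hF.comp (by fun_prop))]
      simp [Fin.sum_univ_succ]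
    have hm := fun k : ℕ => measurable_radialIntegral_add k hF
    have hm' : ∀ k : ℕ, Measurable fun z : ℝ =>
        radialIntegral k fun b => F ((max (|z| - s) 0) ^ 2 + b) := fun k =>
      (hm k).comp (g := fun a => radialIntegral k fun b => F (a + b))
        (f := fun z : ℝ => (max (|z| - s) 0) ^ 2) (by fun_prop)
    simp_rw [e1]
    rw [lintegral_finsetSum _ fun ij _ => ((hm' _).const_mul _).const_mul _]
    have e2 : ∀ ij : ℕ × ℕ, ∫⁻ z : ℝ, (n.choose ij.1 : ENNReal) *
          (ENNReal.ofReal (2 * s) ^ ij.2 *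
            radialIntegral ij.1 fun b => F ((max (|z| - s) 0) ^ 2 + b)) =
        (n.choose ij.1 : ENNReal) * (ENNReal.ofReal (2 * s) ^ (ij.2 + 1) * radialIntegral ij.1 F)
        + (n.choose ij.1 : ENNReal) *
          (ENNReal.ofReal (2 * s) ^ ij.2 * radialIntegral (ij.1 + 1) F) := by
      intro ij
      rw [lintegral_const_mul _ ((hm' _).const_mul _), lintegral_const_mul _ (hm' _),
        lintegral_excess_sq (hm _) hs, radialIntegral_succ _ hF]
      simp only [zero_add]
      ring
    simp_rw [e2]
    rw [Finset.sum_add_distrib]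
    have key := Finset.sum_antidiagonal_choose_succ_mul
      (fun i j => ENNReal.ofReal (2 * s) ^ j * radialIntegral i F) n
    rw [key]
    congr 1
    refine Finset.sum_congr rfl fun ij hij => ?_
    rw [← Finset.HasAntidiagonal.mem_antidiagonal.1 hij, Nat.choose_symm_add]

/-- The volume of the unit ball of `ℝᵏ`. -/
noncomputable def ballVolume (k : ℕ) : ℝ := Real.sqrt Real.pi ^ k / Real.Gamma (k / 2 + 1)

theorem ballVolume_pos (k : ℕ) : 0 < ballVolume k := by
  unfold ballVolume
  have := Real.Gamma_pos_of_pos (by positivity : (0 : ℝ) < k / 2 + 1)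
  positivity

theorem radialIntegral_ball (k : ℕ) {r : ℝ} (hr : 0 ≤ r) :
    radialIntegral k ((Set.Iic (r ^ 2)).indicator 1) = ENNReal.ofReal (r ^ k * ballVolume k) := by
  have e : ∀ y : Fin k → ℝ, (Set.Iic (r ^ 2)).indicator (1 : ℝ → ENNReal) (∑ i, y i ^ 2)
      = {y : Fin k → ℝ | ∑ i, y i ^ 2 ≤ r ^ 2}.indicator 1 y := fun y => rfl
  unfold radialIntegral
  simp_rw [e]
  rw [lintegral_indicator_one (measurableSet_le (by fun_prop) (by fun_prop))]
  rcases Nat.eq_zero_or_pos k with rfl | hk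
  · simp [ballVolume, sq_nonneg, volume_pi]
  · have : Nonempty (Fin k) := ⟨⟨0, hk⟩⟩
    have hb := EuclideanSpace.volume_closedBall (Fin k) 0 r
    rw [← (PiLp.volume_preserving_toLp (Fin k)).measure_preimage
      Metric.isClosed_closedBall.measurableSet.nullMeasurableSet] at hb
    rw [ENNReal.ofReal_mul (by positivity), ENNReal.ofReal_pow hr]
    rw [Fintype.card_fin] at hb
    rw [ballVolume, ← hb]
    congr 1
    ext y
    simp [EuclideanSpace.norm_eq, Real.sqrt_le_left, hr]

theorem integral_pow_mul_one_sub_pow (a b : ℕ) :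
    ∫ t in (0 : ℝ)..1, t ^ a * (1 - t) ^ b
      = (a.factorial * b.factorial : ℝ) / (a + b + 1).factorial := by
  induction b generalizing a with
  | zero =>
    simp only [pow_zero, mul_one, integral_pow, Nat.factorial_zero, Nat.cast_one, add_zero,
      Nat.factorial_succ, Nat.cast_mul, one_pow]
    have : (a.factorial : ℝ) ≠ 0 := by exact_mod_cast a.factorial_ne_zero
    push_cast
    field_simp
    simp
  | succ b ih =>
    have e : ∀ t : ℝ, t ^ a * (1 - t) ^ (b + 1) = t ^ a * (1 - t) ^ b - t ^ (a + 1) * (1 - t) ^ b :=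
      fun t => by ring
    simp_rw [e]
    rw [intervalIntegral.integral_sub (Continuous.intervalIntegrable (by fun_prop) _ _)
      (Continuous.intervalIntegrable (by fun_prop) _ _), ih, ih]
    have h1 : a + 1 + b + 1 = (a + b + 1) + 1 := by ring
    have h2 : a + (b + 1) + 1 = (a + b + 1) + 1 := by ring
    rw [h1, h2, Nat.factorial_succ (a + b + 1), Nat.factorial_succ a, Nat.factorial_succ b]
    have : ((a + b + 1).factorial : ℝ) ≠ 0 := by exact_mod_cast (a + b + 1).factorial_ne_zero
    push_cast
    field_simp
    ring

/-- The summands of the volume of `bodyF2 n`. -/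
noncomputable def coeff (n k : ℕ) : ℝ := bottomRadius n ^ k * ballVolume k

theorem coeff_nonneg (n k : ℕ) : 0 ≤ coeff n k :=
  mul_nonneg (pow_nonneg (bottomRadius_nonneg n) k) (ballVolume_pos k).le

theorem volume_section {n : ℕ} {t : ℝ} (h0 : 0 ≤ t) (h1 : t ≤ 1) :
    volume {x : Fin n → ℝ | ∑ i, (max (|x i| - t / 2) 0) ^ 2 ≤ ((1 - t) * bottomRadius n) ^ 2} =
      ENNReal.ofReal (∑ ij ∈ Finset.HasAntidiagonal.antidiagonal n,
        n.choose ij.1 * coeff n ij.1 * (t ^ ij.2 * (1 - t) ^ ij.1)) := by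
  set r := (1 - t) * bottomRadius n with hr
  have hr0 : 0 ≤ r := mul_nonneg (by linarith) (bottomRadius_nonneg n)
  rw [← lintegral_indicator_one (measurableSet_le (by fun_prop) (by fun_prop))]
  have h := lintegral_sum_excess_sq n (s := t / 2) (by linarith)
    (F := (Set.Iic (r ^ 2)).indicator 1) (measurable_one.indicator measurableSet_Iic)
  refine Eq.trans ?_ (h.trans ?_)
  · rfl
  · rw [ENNReal.ofReal_sum_of_nonneg]
    · refine Finset.sum_congr rfl fun ij _ => ?_
      rw [radialIntegral_ball _ hr0, ← ENNReal.ofReal_pow (by linarith), ← ENNReal.ofReal_natCast,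
        ← ENNReal.ofReal_mul (by positivity), ← ENNReal.ofReal_mul (by positivity)]
      congr 1
      rw [hr, coeff, show 2 * (t / 2) = t by ring, mul_pow]
      ring
    · intro ij _
      have := coeff_nonneg n ij.1
      have : 0 ≤ 1 - t := by linarith
      positivity

theorem setLIntegral_bodyF2_last_pow (n p : ℕ) :
    ∫⁻ y in bodyF2 n, ENNReal.ofReal (y (Fin.last n) ^ p) =
      ENNReal.ofReal (∑ ij ∈ Finset.HasAntidiagonal.antidiagonal n, n.choose ij.1 * coeff n ij.1 *
        (((p + ij.2).factorial * ij.1.factorial : ℝ) / (p + ij.2 + ij.1 + 1).factorial)) := by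
  set S : ℝ → Set (Fin n → ℝ) := fun t =>
    {x | ∑ i, (max (|x i| - t / 2) 0) ^ 2 ≤ ((1 - t) * bottomRadius n) ^ 2} with hS
  have hmeas : Measurable fun y : EuclideanSpace ℝ (Fin (n + 1)) =>
      (bodyF2 n).indicator (fun y => ENNReal.ofReal (y (Fin.last n) ^ p)) y :=
    Measurable.indicator (by fun_prop) (isClosed_bodyF2 n).measurableSet
  rw [← lintegral_indicator (isClosed_bodyF2 n).measurableSet,
    ← (PiLp.volume_preserving_toLp (Fin (n + 1))).lintegral_comp hmeas,
    lintegral_pi_fin_succ (Fin.last n) (f := fun x => (bodyF2 n).indicator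
      (fun y => ENNReal.ofReal (y (Fin.last n) ^ p)) (WithLp.toLp 2 x))
      (hmeas.comp (PiLp.volume_preserving_toLp (Fin (n + 1))).measurable)]
  have e1 : ∀ t : ℝ, ∫⁻ y : Fin n → ℝ, (bodyF2 n).indicator
        (fun y => ENNReal.ofReal (y (Fin.last n) ^ p))
          (WithLp.toLp 2 (Fin.insertNth (α := fun _ => ℝ) (Fin.last n) t y))
      -- The interval `[0, 1]` is written this way so that the null set `{0}` can be dropped,
      -- leaving the form of an interval integral.
      = (Set.Ioc 0 1 ∪ {0}).indicator (fun t => ENNReal.ofReal (∑ ij ∈ Finset.HasAntidiagonal.antidiagonal n,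
        n.choose ij.1 * coeff n ij.1 * (t ^ (p + ij.2) * (1 - t) ^ ij.1))) t := by
    intro t
    by_cases ht : 0 ≤ t ∧ t ≤ 1
    · have ht' : t ∈ Set.Ioc (0 : ℝ) 1 ∪ {0} := by
        rcases ht.1.eq_or_lt with h | h
        · exact Or.inr h.symm
        · exact Or.inl ⟨h, ht.2⟩
      have e : ∀ y : Fin n → ℝ, (bodyF2 n).indicator
        (fun y => ENNReal.ofReal (y (Fin.last n) ^ p))
          (WithLp.toLp 2 (Fin.insertNth (α := fun _ => ℝ) (Fin.last n) t y))
          = (S t).indicator (fun _ => ENNReal.ofReal (t ^ p)) y := by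
        intro y
        have : WithLp.toLp 2 (Fin.insertNth (α := fun _ => ℝ) (Fin.last n) t y) ∈ bodyF2 n ↔
            y ∈ S t := by
          rw [mem_bodyF2_iff]
          simp [hS, ht.1, ht.2, Fin.insertNth_last']
        by_cases hy : y ∈ S t
        · rw [Set.indicator_of_mem hy, Set.indicator_of_mem (this.2 hy)]
          simp
        · rw [Set.indicator_of_notMem hy, Set.indicator_of_notMem (mt this.1 hy)]
      simp_rw [e]
      rw [lintegral_indicator_const (measurableSet_le (by fun_prop) (by fun_prop)),
        Set.indicator_of_mem ht', volume_section ht.1 ht.2,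
        ← ENNReal.ofReal_mul (pow_nonneg ht.1 p), Finset.mul_sum]
      congr 1
      refine Finset.sum_congr rfl fun ij _ => ?_
      ring
    · have ht' : t ∉ Set.Ioc (0 : ℝ) 1 ∪ {0} := by
        rintro (h | rfl)
        · exact ht ⟨h.1.le, h.2⟩
        · exact ht ⟨le_rfl, zero_le_one⟩
      rw [Set.indicator_of_notMem ht']
      refine lintegral_eq_zero_of_ae_eq_zero (Eventually.of_forall fun y => ?_)
      refine Set.indicator_of_notMem (fun h => ht ?_) _
      have := mem_bodyF2_iff.1 h
      simp only [Fin.insertNth_apply_same] at this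
      exact ⟨this.1, this.2.1⟩
  simp_rw [e1]
  have hc : Continuous fun t : ℝ => ∑ ij ∈ Finset.HasAntidiagonal.antidiagonal n,
        n.choose ij.1 * coeff n ij.1 * (t ^ (p + ij.2) * (1 - t) ^ ij.1) := by fun_prop
  rw [lintegral_indicator (measurableSet_Ioc.union (measurableSet_singleton 0)),
    setLIntegral_congr (union_ae_eq_left_of_ae_eq_empty (by simp)),
    ← ofReal_integral_eq_lintegral_ofReal (hc.integrableOn_Ioc)]
  · rw [← intervalIntegral.integral_of_le zero_le_one, intervalIntegral.integral_finsetSum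
      fun ij _ => Continuous.intervalIntegrable (by fun_prop) _ _]
    congr 1
    refine Finset.sum_congr rfl fun ij _ => ?_
    rw [intervalIntegral.integral_const_mul, integral_pow_mul_one_sub_pow]
  · refine (ae_restrict_iff' measurableSet_Ioc).2 (Eventually.of_forall fun t ht => ?_)
    refine Finset.sum_nonneg fun ij _ => ?_
    have := coeff_nonneg n ij.1
    have : 0 ≤ 1 - t := by linarith [ht.2]
    have := ht.1.le
    positivity

theorem sum_coeff_pos {n : ℕ} : 0 < ∑ k ∈ Finset.range (n + 1), coeff n k := by
  refine Finset.sum_pos' (fun k _ => coeff_nonneg n k) ⟨0, by simp, ?_⟩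
  simpa [coeff] using ballVolume_pos 0

theorem volume_real_bodyF2 (n : ℕ) :
    volume.real (bodyF2 n) = (∑ k ∈ Finset.range (n + 1), coeff n k) / (n + 1) := by
  have h := setLIntegral_bodyF2_last_pow n 0
  simp only [pow_zero, ENNReal.ofReal_one, lintegral_const, one_mul, Measure.restrict_apply_univ]
    at h
  rw [Measure.real, h, ENNReal.toReal_ofReal, Finset.sum_div,
    Finset.Nat.sum_antidiagonal_eq_sum_range_succ (fun i j => (n.choose i : ℝ) * coeff n i *
      (((0 + j).factorial * i.factorial : ℝ) / (0 + j + i + 1).factorial))]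
  · refine Finset.sum_congr rfl fun k hk => ?_
    have hk' : k ≤ n := by simpa [Nat.lt_succ_iff] using hk
    have hf : (n.choose k : ℝ) ≠ 0 := by exact_mod_cast (Nat.choose_pos hk').ne'
    have hch : (n.choose k : ℝ) * k.factorial * (n - k).factorial = n.factorial := by
      exact_mod_cast Nat.choose_mul_factorial_mul_factorial hk'
    rw [zero_add, Nat.sub_add_cancel hk', Nat.factorial_succ, Nat.cast_mul, ← hch]
    push_cast
    field_simp
  · refine Finset.sum_nonneg fun ij _ => ?_
    have := coeff_nonneg n ij.1
    positivity

theorem integral_last_bodyF2 (n : ℕ) :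
    ∫ y in bodyF2 n, y (Fin.last n) =
      (∑ k ∈ Finset.range (n + 1), (n + 1 - k) * coeff n k) / ((n + 1) * (n + 2)) := by
  have h := setLIntegral_bodyF2_last_pow n 1
  simp only [pow_one] at h
  rw [integral_eq_lintegral_of_nonneg_ae _ (by fun_prop), h, ENNReal.toReal_ofReal, Finset.sum_div,
    Finset.Nat.sum_antidiagonal_eq_sum_range_succ (fun i j => (n.choose i : ℝ) * coeff n i *
      (((1 + j).factorial * i.factorial : ℝ) / (1 + j + i + 1).factorial))]
  · refine Finset.sum_congr rfl fun k hk => ?_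
    have hk' : k ≤ n := by simpa [Nat.lt_succ_iff] using hk
    have hf : (n.choose k : ℝ) ≠ 0 := by exact_mod_cast (Nat.choose_pos hk').ne'
    have hch : (n.choose k : ℝ) * k.factorial * (n - k).factorial = n.factorial := by
      exact_mod_cast Nat.choose_mul_factorial_mul_factorial hk'
    rw [show 1 + (n - k) + k + 1 = n + 1 + 1 by omega, add_comm 1 (n - k),
      Nat.factorial_succ (n + 1), Nat.factorial_succ n, Nat.factorial_succ (n - k), Nat.cast_mul,
      Nat.cast_mul, Nat.cast_mul, Nat.cast_add, Nat.cast_sub hk', ← hch]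
    push_cast
    field_simp
    ring
  · refine Finset.sum_nonneg fun ij _ => ?_
    have := coeff_nonneg n ij.1
    positivity
  · refine (ae_restrict_iff' (isClosed_bodyF2 n).measurableSet).2 (Eventually.of_forall fun y hy => ?_)
    exact (mem_bodyF2_iff.1 hy).1

/-! ### The centroid as a weighted mean -/

theorem isCompact_bodyF2 (n : ℕ) : IsCompact (bodyF2 n) := by
  refine Metric.isCompact_of_isClosed_isBounded (isClosed_bodyF2 n) ?_
  refine isBounded_iff_forall_norm_le.2 ⟨Real.sqrt (n * (bottomRadius n + 1 / 2) ^ 2 + 1), ?_⟩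
  intro y hy
  have hR := bottomRadius_nonneg n
  obtain ⟨h0, h1, -⟩ := mem_bodyF2_iff.1 hy
  refine Real.le_sqrt_of_sq_le ?_
  rw [EuclideanSpace.norm_sq_eq, Fin.sum_univ_castSucc]
  refine add_le_add ?_ ?_
  · calc ∑ i : Fin n, ‖y i.castSucc‖ ^ 2 ≤ ∑ _i : Fin n, (bottomRadius n + 1 / 2) ^ 2 := by
          refine Finset.sum_le_sum fun i _ => pow_le_pow_left₀ (norm_nonneg _) ?_ 2
          refine (abs_le_width_of_mem hy i).trans ?_
          unfold width
          nlinarith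
      _ = _ := by simp
  · rw [Real.norm_eq_abs, sq_abs]
    nlinarith

/-- The reflection of `ℝⁿ⁺¹` in the last coordinate axis. -/
noncomputable def axisReflection (n : ℕ) :
    EuclideanSpace ℝ (Fin (n + 1)) ≃ₗᵢ[ℝ] EuclideanSpace ℝ (Fin (n + 1)) :=
  LinearIsometryEquiv.piLpCongrRight 2 fun i =>
    if i = Fin.last n then LinearIsometryEquiv.refl ℝ ℝ else LinearIsometryEquiv.neg ℝ

@[simp] theorem axisReflection_last (n : ℕ) (y : EuclideanSpace ℝ (Fin (n + 1))) :
    axisReflection n y (Fin.last n) = y (Fin.last n) := by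
  simp [axisReflection]

@[simp] theorem axisReflection_castSucc (n : ℕ) (y : EuclideanSpace ℝ (Fin (n + 1))) (i : Fin n) :
    axisReflection n y i.castSucc = -y i.castSucc := by
  simp [axisReflection, Fin.castSucc_ne_last]

theorem integral_castSucc_bodyF2 (n : ℕ) (i : Fin n) :
    ∫ y in bodyF2 n, y i.castSucc = 0 := by
  have h := (axisReflection n).measurePreserving.setIntegral_preimage_emb
    (axisReflection n).toHomeomorph.measurableEmbedding (fun y => y i.castSucc) (bodyF2 n)
  have hpre : axisReflection n ⁻¹' bodyF2 n = bodyF2 n := by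
    ext y
    rw [Set.mem_preimage, mem_bodyF2_iff, mem_bodyF2_iff]
    simp
  rw [hpre] at h
  simp only [axisReflection_castSucc, integral_neg] at h
  linarith

theorem centroid_bodyF2 (n : ℕ) :
    centroid (bodyF2 n) = ((∑ k ∈ Finset.range (n + 1), (n + 1 - k) * coeff n k) /
      ((n + 2) * ∑ k ∈ Finset.range (n + 1), coeff n k)) • eLast n := by
  have hint : IntegrableOn (fun y : EuclideanSpace ℝ (Fin (n + 1)) => y) (bodyF2 n) :=
    continuousOn_id.integrableOn_compact (isCompact_bodyF2 n)
  have hco : ∀ i, (∫ y in bodyF2 n, y) i = ∫ y in bodyF2 n, y i := fun i =>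
    ((EuclideanSpace.proj (𝕜 := ℝ) i).integral_comp_comm hint).symm
  have hS := sum_coeff_pos (n := n)
  ext i
  rw [centroid, PiLp.smul_apply, hco]
  refine Fin.lastCases ?_ (fun i => ?_) i
  · rw [integral_last_bodyF2, volume_real_bodyF2]
    simp [eLast]
    field_simp
  · rw [integral_castSucc_bodyF2]
    simp [eLast, Fin.castSucc_ne_last]


/-! ### Asymptotics of the centroid -/

theorem ballVolume_add_two (k : ℕ) :
    ((k : ℝ) + 2) * ballVolume (k + 2) = 2 * Real.pi * ballVolume k := by
  have h0 : (0 : ℝ) < k / 2 + 1 := by positivity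
  have hG := Real.Gamma_pos_of_pos h0
  have e : Real.Gamma (((k + 2 : ℕ) : ℝ) / 2 + 1) = (k / 2 + 1) * Real.Gamma (k / 2 + 1) := by
    rw [← Real.Gamma_add_one h0.ne']
    congr 1
    push_cast
    ring
  rw [ballVolume, ballVolume, e, pow_add, Real.sq_sqrt Real.pi_pos.le]
  field_simp

theorem coeff_add_two (n k : ℕ) :
    ((k : ℝ) + 2) * coeff n (k + 2) = n / Real.exp 1 * coeff n k := by
  have h := ballVolume_add_two k
  have hR := sq_bottomRadius n
  calc ((k : ℝ) + 2) * coeff n (k + 2)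
      = bottomRadius n ^ k * bottomRadius n ^ 2 * (((k : ℝ) + 2) * ballVolume (k + 2)) := by
        rw [coeff, pow_add]; ring
    _ = n / Real.exp 1 * coeff n k := by
        rw [h, hR, coeff]
        field_simp

theorem sum_mul_coeff (n N : ℕ) :
    ∑ k ∈ Finset.range (N + 2), (k : ℝ) * coeff n k
      = coeff n 1 + n / Real.exp 1 * ∑ k ∈ Finset.range N, coeff n k := by
  rw [Finset.sum_range_succ', Finset.sum_range_succ', Finset.mul_sum]
  have : ∀ k : ℕ, ((k + 1 + 1 : ℕ) : ℝ) * coeff n (k + 1 + 1) = n / Real.exp 1 * coeff n k := by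
    intro k
    rw [← coeff_add_two]
    push_cast
    ring
  simp_rw [this]
  simp [add_comm]

/-- From `k + 2 ≥ 3n / 4` on, the ratio `c_(k+2) / c_k = n / (e (k + 2))` is at most `4 / (3e) <
1/2`. -/
theorem two_pow_mul_coeff_le {n : ℕ} {i : ℕ} (hi : 3 * n ≤ 4 * (i + 2)) (j : ℕ) :
    2 ^ j * coeff n (i + 2 * j) ≤ coeff n i := by
  induction j with
  | zero => simp
  | succ j ih =>
    refine le_trans ?_ ih
    have h := coeff_add_two n (i + 2 * j)
    have hc := coeff_nonneg n (i + 2 * j + 2)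
    have hc' := coeff_nonneg n (i + 2 * j)
    have he := Real.exp_one_gt_d9
    have hi' : 3 * (n : ℝ) ≤ 4 * (i + 2) := by exact_mod_cast hi
    have h2 : (((i + 2 * j : ℕ) : ℝ) + 2) * Real.exp 1 * coeff n (i + 2 * j + 2)
        = n * coeff n (i + 2 * j) := by
      rw [mul_assoc, mul_left_comm, h]
      field_simp
    have hn0 : (0 : ℝ) ≤ n := n.cast_nonneg
    have h3 : 2 * (n : ℝ) ≤ ((i + 2 * j : ℕ) + 2) * Real.exp 1 := by
      push_cast
      have : (0 : ℝ) ≤ j := j.cast_nonneg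
      have : (0 : ℝ) ≤ i := i.cast_nonneg
      nlinarith
    have key : 2 * coeff n (i + 2 * j + 2) ≤ coeff n (i + 2 * j) := by
      rcases Nat.eq_zero_or_pos n with h0 | h0
      · have hz : coeff n (i + 2 * j + 2) = 0 := by
          rw [coeff, h0, bottomRadius]
          simp
        rw [hz]
        simpa using hc'
      · have hn' : (0 : ℝ) < n := by exact_mod_cast h0
        have := mul_le_mul_of_nonneg_right h3 hc
        rw [h2] at this
        exact le_of_mul_le_mul_left (by linarith) hn'
    rw [show i + 2 * (j + 1) = i + 2 * j + 2 by ring, pow_succ, mul_assoc]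
    gcongr

theorem coeff_le_sum {n k : ℕ} (hk : k ≤ n) :
    coeff n k ≤ ∑ k ∈ Finset.range (n + 1), coeff n k :=
  Finset.single_le_sum (f := coeff n) (fun k _ => coeff_nonneg n k)
    (by simpa [Nat.lt_succ_iff] using hk)

theorem coeff_le_half_pow_mul_sum {n k : ℕ} (hk : k ≤ n) (hk' : n ≤ k + 1) :
    coeff n k ≤ (1 / 2) ^ (n / 8) * ∑ k ∈ Finset.range (n + 1), coeff n k := by
  -- Going down from `k ≥ n - 1` by `n / 8` steps of two stays in the range where each step at least
  -- doubles the coefficient.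
  have h := two_pow_mul_coeff_le (n := n) (i := k - 2 * (n / 8)) (by omega) (n / 8)
  rw [show k - 2 * (n / 8) + 2 * (n / 8) = k by omega] at h
  have h2 := h.trans (coeff_le_sum (n := n) (k := k - 2 * (n / 8)) (by omega))
  rw [one_div, inv_pow, ← div_eq_inv_mul, le_div_iff₀ (by positivity)]
  linarith

/-- The difference of the weighted mean of the indices and `n / e`. -/
noncomputable def meanError (n : ℕ) : ℝ :=
  (coeff n 1 - n / Real.exp 1 * (coeff n (n - 1) + coeff n n)) /
    ∑ k ∈ Finset.range (n + 1), coeff n k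

theorem centroid_coordinate_eq {n : ℕ} (hn : 1 ≤ n) :
    (∑ k ∈ Finset.range (n + 1), (n + 1 - k) * coeff n k) /
      ((n + 2) * ∑ k ∈ Finset.range (n + 1), coeff n k)
      = (n + 1 - n / Real.exp 1 - meanError n) / (n + 2) := by
  have hS := sum_coeff_pos (n := n)
  have e1 : ∑ k ∈ Finset.range (n + 1), ((n : ℝ) + 1 - k) * coeff n k
      = (n + 1) * ∑ k ∈ Finset.range (n + 1), coeff n k
        - ∑ k ∈ Finset.range (n + 1), (k : ℝ) * coeff n k := by
    rw [Finset.mul_sum, ← Finset.sum_sub_distrib]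
    exact Finset.sum_congr rfl fun k _ => by ring
  obtain ⟨N, rfl⟩ : ∃ N, n = N + 1 := ⟨n - 1, by omega⟩
  have e2 := sum_mul_coeff (N + 1) N
  have e3 : ∑ k ∈ Finset.range (N + 1 + 1), coeff (N + 1) k
      = ∑ k ∈ Finset.range N, coeff (N + 1) k + coeff (N + 1) N + coeff (N + 1) (N + 1) := by
    rw [Finset.sum_range_succ, Finset.sum_range_succ]
  rw [e1, e2, meanError, Nat.add_sub_cancel]
  have e4 : ∑ k ∈ Finset.range N, coeff (N + 1) k
      = ∑ k ∈ Finset.range (N + 1 + 1), coeff (N + 1) k - coeff (N + 1) N - coeff (N + 1) (N + 1) := by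
    linarith
  rw [e4]
  set S := ∑ k ∈ Finset.range (N + 1 + 1), coeff (N + 1) k
  field_simp
  ring

theorem abs_meanError_le {n : ℕ} (hn : 3 ≤ n) :
    |meanError n| ≤ 9 / n + 2 * (n * (1 / 2) ^ (n / 8)) := by
  have hS := sum_coeff_pos (n := n)
  have hn0 : (0 : ℝ) < n := by exact_mod_cast (by omega : 0 < n)
  have h1 := coeff_le_half_pow_mul_sum (n := n) (k := n - 1) (by omega) (by omega)
  have h2 := coeff_le_half_pow_mul_sum (n := n) (k := n) le_rfl (by omega)
  have h3 := coeff_le_sum hn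
  have h4 := coeff_add_two n 1
  have p0 := coeff_nonneg n 1
  have p1 := coeff_nonneg n (n - 1)
  have p2 := coeff_nonneg n n
  have he := Real.exp_one_lt_three
  have he1 : 1 ≤ Real.exp 1 := Real.one_le_exp zero_le_one
  have hc1 : coeff n 1 ≤ 9 / n * ∑ k ∈ Finset.range (n + 1), coeff n k := by
    -- The recursion read backwards shows that `c_1` is smaller than `c_3` by a factor of order `1 /
    -- n`, and `3e < 9`.
    have e : coeff n 1 = 3 * Real.exp 1 / n * coeff n 3 := by
      norm_num at h4
      have : coeff n 1 = Real.exp 1 / n * (n / Real.exp 1 * coeff n 1) := by field_simp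
      rw [this, ← h4]
      ring
    rw [e]
    refine mul_le_mul ?_ h3 (coeff_nonneg n 3) (by positivity)
    gcongr
    linarith
  have hle : n / Real.exp 1 * (coeff n (n - 1) + coeff n n)
      ≤ 2 * (n * (1 / 2) ^ (n / 8)) * ∑ k ∈ Finset.range (n + 1), coeff n k := by
    calc n / Real.exp 1 * (coeff n (n - 1) + coeff n n)
        ≤ n * (coeff n (n - 1) + coeff n n) := by
          gcongr
          exact div_le_self hn0.le he1
      _ ≤ n * ((1 / 2) ^ (n / 8) * (∑ k ∈ Finset.range (n + 1), coeff n k)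
          + (1 / 2) ^ (n / 8) * ∑ k ∈ Finset.range (n + 1), coeff n k) := by gcongr
      _ = _ := by ring
  have hnn : 0 ≤ n / Real.exp 1 * (coeff n (n - 1) + coeff n n) := by positivity
  rw [meanError, abs_div, abs_of_pos hS, div_le_iff₀ hS, add_mul, abs_le]
  constructor <;> linarith

theorem tendsto_nat_mul_half_pow_div :
    Tendsto (fun n : ℕ => (n : ℝ) * (1 / 2) ^ (n / 8)) atTop (nhds 0) := by
  have hq : Tendsto (fun n : ℕ => n / 8) atTop atTop := Nat.tendsto_div_const_atTop (by norm_num)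
  have h1 : Tendsto (fun q : ℕ => 8 * ((q : ℝ) * (1 / 2) ^ q) + 8 * (1 / 2 : ℝ) ^ q) atTop
      (nhds (8 * 0 + 8 * 0)) :=
    ((tendsto_self_mul_const_pow_of_lt_one (by norm_num) (by norm_num)).const_mul 8).add
      ((tendsto_pow_atTop_nhds_zero_of_lt_one (by norm_num) (by norm_num)).const_mul 8)
  norm_num at h1
  refine squeeze_zero (fun n => by positivity) (fun n => ?_) (h1.comp hq)
  have h : (n : ℝ) ≤ 8 * (n / 8 : ℕ) + 8 := by
    exact_mod_cast (by omega : n ≤ 8 * (n / 8) + 8)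
  have := mul_le_mul_of_nonneg_right h (by positivity : (0 : ℝ) ≤ (1 / 2) ^ (n / 8))
  simp only [Function.comp_def]
  linarith

theorem tendsto_meanError : Tendsto meanError atTop (nhds 0) := by
  have h : Tendsto (fun n : ℕ => 9 / (n : ℝ) + 2 * (n * (1 / 2) ^ (n / 8))) atTop
      (nhds (0 + 2 * 0)) :=
    (tendsto_const_div_atTop_nhds_zero_nat 9).add (tendsto_nat_mul_half_pow_div.const_mul 2)
  norm_num at h
  refine squeeze_zero_norm' ?_ h
  filter_upwards [eventually_ge_atTop 3] with n hn
  simpa using abs_meanError_le hn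

theorem isLittleO_one_div_nat_of_tendsto {f : ℕ → ℝ}
    (h : Tendsto (fun n : ℕ => (n : ℝ) * f n) atTop (nhds 0)) :
    f =o[atTop] fun n : ℕ => 1 / (n : ℝ) := by
  refine isLittleO_of_tendsto' ?_ ?_
  · filter_upwards [eventually_gt_atTop 0] with n hn h0
    have : (n : ℝ) ≠ 0 := by exact_mod_cast hn.ne'
    simp [this] at h0
  · refine h.congr fun n => ?_
    rw [div_div_eq_mul_div, div_one, mul_comm]

theorem tendsto_two_div_nat_add_two :
    Tendsto (fun n : ℕ => 2 / ((n : ℝ) + 2)) atTop (nhds 0) :=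
  Tendsto.const_div_atTop (tendsto_atTop_add_const_right _ _ tendsto_natCast_atTop_atTop) 2

theorem isLittleO_centroid_coordinate :
    (fun n : ℕ => (∑ k ∈ Finset.range (n + 1), ((n : ℝ) + 1 - k) * coeff n k) /
      ((n + 2) * ∑ k ∈ Finset.range (n + 1), coeff n k) -
        (1 - 1 / Real.exp 1 - 1 / (n : ℝ) * (1 - 2 / Real.exp 1)))
      =o[atTop] fun n : ℕ => 1 / (n : ℝ) := by
  refine isLittleO_one_div_nat_of_tendsto ?_
  have h2 := tendsto_two_div_nat_add_two
  have h : Tendsto (fun n : ℕ => (1 - 2 / Real.exp 1) * (2 / ((n : ℝ) + 2))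
      - meanError n * (1 - 2 / ((n : ℝ) + 2))) atTop
      (nhds ((1 - 2 / Real.exp 1) * 0 - 0 * (1 - 0))) :=
    (h2.const_mul _).sub (tendsto_meanError.mul (h2.const_sub 1))
  simp only [mul_zero, zero_mul, sub_zero] at h
  refine h.congr' ?_
  filter_upwards [eventually_ge_atTop 1] with n hn
  have : (n : ℝ) ≠ 0 := by exact_mod_cast (by omega : n ≠ 0)
  rw [centroid_coordinate_eq hn]
  field_simp
  ring

/-! ### Asymptotics of the John centre -/

theorem tendsto_bottomRadius : Tendsto bottomRadius atTop atTop := by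
  refine Real.tendsto_sqrt_atTop.comp ?_
  exact tendsto_natCast_atTop_atTop.atTop_div_const (by positivity)

theorem isLittleO_john_coordinate {u v : ℕ → ℝ} (h : ∀ n, IsOptimal n (u n) (v n)) :
    (fun n : ℕ => (u n + v n) / 2 - 1 / (n : ℝ)) =o[atTop] fun n : ℕ => 1 / (n : ℝ) := by
  refine isLittleO_one_div_nat_of_tendsto ?_
  have hm : Tendsto (fun n => (1 / 2) / (bottomRadius n - 1 / 2)) atTop (nhds 0) :=
    Tendsto.const_div_atTop (tendsto_atTop_add_const_right _ (-(1 / 2)) tendsto_bottomRadius) _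
  have h1 : Tendsto (fun n : ℕ => (1 - 2 / ((n : ℝ) + 2)) *
      (1 + (1 / 2) / (bottomRadius n - 1 / 2)) - 1) atTop (nhds ((1 - 0) * (1 + 0) - 1)) :=
    ((tendsto_two_div_nat_add_two.const_sub 1).mul (hm.const_add 1)).sub_const 1
  norm_num at h1
  refine h1.congr' ?_
  filter_upwards [eventually_ge_atTop 2, tendsto_bottomRadius.eventually_ge_atTop 1] with n hn hR
  have hn2 : (2 : ℝ) ≤ n := by exact_mod_cast hn
  -- For `R ≥ 1` and `n ≥ 2`, `(R - 1/2)(n + 2) ≥ 4R - 2 ≥ 2R`, so the critical point lies in `[0,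
  -- 1]`.
  have hopt := isOptimal_of_half_lt (n := n) (by linarith) (by nlinarith)
  obtain ⟨hu, hv⟩ := (h n).unique (by omega) hopt
  rw [hu, hv]
  obtain ⟨m, hmR⟩ : ∃ m, bottomRadius n = m + 1 / 2 := ⟨bottomRadius n - 1 / 2, by ring⟩
  have hm0 : m ≠ 0 := by linarith
  rw [hmR, add_sub_cancel_right]
  field_simp
  ring

end JohnCentroid

theorem mainTheorem6 :
    ∃ j g : ℕ → ℝ,
      (∀ n : ℕ, 1 ≤ n →
        (∀ p : EuclideanSpace ℝ (Fin (n + 1)),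
          JohnCentroid.IsJohnCenter (JohnCentroid.bodyF2 n) p ↔
            p = j n • JohnCentroid.eLast n) ∧
        JohnCentroid.centroid (JohnCentroid.bodyF2 n) = g n • JohnCentroid.eLast n) ∧
      (fun n : ℕ => j n - 1 / (n : ℝ)) =o[atTop] (fun n : ℕ => 1 / (n : ℝ)) ∧
      (fun n : ℕ => g n -
          (1 - 1 / Real.exp 1 - 1 / (n : ℝ) * (1 - 2 / Real.exp 1)))
        =o[atTop] (fun n : ℕ => 1 / (n : ℝ)) := by
  choose u v h using JohnCentroid.exists_isOptimal
  exact ⟨_, _, fun n hn => ⟨(h n).isJohnCenter_iff hn, JohnCentroid.centroid_bodyF2 n⟩,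
    JohnCentroid.isLittleO_john_coordinate h, JohnCentroid.isLittleO_centroid_coordinate⟩
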